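/- **Definitions.** All graphs are finite, simple and undirected. A tree $t$-spanner of a graph $G$ is a subgraph $T$ of $G$ that is a tree and such that, for all vertices $x,y$ of $G$, the distance of $x$ and $y$ in $T$ is at most $t$ times their distance in $G$ (in particular, $T$ contains all vertices of $G$). A literal is a variable or the negation of a variable. An instance $I$ of 3-SAT is a finite set of clauses; each clause is the disjunction of exactly three distinct literals, given in some order. It is satisfiable if some truth assignment to the variables makes every clause true. **Construction.** Given $I$, let $X(I)$ be the set of variables that occur in $I$, and let $C(I)$ be the set of clauses of $I$ that do not contain both a variable and its negation. The graph $f(I)$ has the following pairwise distinct vertices: six vertices $u,v,h_u,h_u',h_v,h_v'$; the variables $x\in X(I)$; and, for every clause $c\in C(I)$, eleven vertices $x_1^c,x_2^c,x_3^c,q_1^c,\dots,q_8^c$. Its edges are the following. 1. The edges $h_uh_u'$, $h_u'u$, $uv$, $vh_v'$, $h_v'h_v$. 2. The edges $xu$ and $xv$ for every $x\in X(I)$. 3. For every $c\in C(I)$ whose literals involve, in order, the variables $x_1,x_2,x_3$: put $g^c=[x_1,x_1^c,x_2,x_2^c,x_3,x_3^c]$; then $g^c_iq^c_j$ is an edge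 whenever $1\le i\le 6$, $1\le j\le 8$ and $M_{i,j}=1$, where $$M=\begin{pmatrix}1&1&1&1&0&0&0&0\\0&0&0&0&1&1&1&1\\1&1&0&0&1&1&0&0\\0&0&1&1&0&0&1&1\\1&0&1&0&1&0&1&0\\0&1&0&1&0&1&0&1\end{pmatrix};$$ for $1\le i\le 3$, $x_i^cu$ is an edge if $x_i$ occurs positively in $c$, and $x_i^cv$ is an edge if $x_i$ occurs negated in $c$; and $q^c_jq^c_{j+1}$ is an edge for $1\le j\le 7$. **Proposition.** The graph $f(I)$ can be computed from $I$ in polynomial time: there is a Turing machine (with finitely many stacks) that, given $I$ written as a string (the list of its clauses, with variables numbered in binary), outputs, in a number of steps bounded by a polynomial in the length of that string, the graph $f(I)$ written as a string (a list of the names of its vertices followed by a list of its edges; since the lists stand for sets, repetitions are allowed). Moreover, for every instance $I$ of 3-SAT, $I$ is satisfiable if and only if $f(I)$ admits a tree $4$-spanner of diameter at most $5$. -/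

import Mathlib

namespace TreeSpanner

/-! ## Tree spanners -/

/-- `T` is a tree `t`-spanner of `G`: a subgraph of `G` on all vertices of `G` which is a tree and
in which the distance of any two vertices is at most `t` times their distance in `G`. (Both graphs
are connected when the first two conditions hold, so no distance below is a junk value.) -/
def IsTreeSpanner {V : Type*} (t : ℕ) (G T : SimpleGraph V) : Prop :=
  T ≤ G ∧ T.IsTree ∧ ∀ x y : V, T.dist x y ≤ t * G.dist x y

/-! ## Instances of 3-SAT -/

/-- A literal: a variable (`pos = true`) or the negation of a variable (`pos = false`). -/
structure Literal where
  var : ℕ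
  pos : Bool
  deriving DecidableEq

/-- A clause: the disjunction of exactly three distinct literals, written in some order. -/
structure Clause where
  lit : Fin 3 → Literal
  distinct : Function.Injective lit

/-- An instance of 3-SAT: a finite set of clauses, written down as a list. (All notions below depend
only on which clauses occur in the list.) -/
abbrev Instance : Type := List Clause

/-- Some truth assignment makes every clause true. -/
def Instance.Satisfiable (I : Instance) : Prop :=
  ∃ A : ℕ → Bool, ∀ c ∈ I, ∃ i, A (c.lit i).var = (c.lit i).pos

/-- `X(I)`: the variables involved in `I`. -/
def Instance.vars (I : Instance) : Set ℕ :=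
  {x | ∃ c ∈ I, ∃ i, (c.lit i).var = x}

/-- The clause contains both a variable and its negation. -/
def Clause.IsTautology (c : Clause) : Prop :=
  ∃ i j, (c.lit i).var = (c.lit j).var ∧ (c.lit i).pos = true ∧ (c.lit j).pos = false

/-- `C(I)`: the clauses of `I` which do not contain both a variable and its negation. -/
def Instance.properClauses (I : Instance) : Set Clause :=
  {c | c ∈ I ∧ ¬ c.IsTautology}

/-! ## The graph `f(I)` -/

/-- The set `H` of six hub vertices. -/
inductive Hub where
  | u | v | hu | hu' | hv | hv'
  deriving DecidableEq

/-- The names of vertices: the hub vertices, a vertex for each variable `x`, and, for each clause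
`c`, the vertices `x_1^c, x_2^c, x_3^c` (`copy c i`) and `q_1^c, …, q_8^c` (`q c j`). -/
inductive Vertex where
  | hub (h : Hub)
  | var (x : ℕ)
  | copy (c : Clause) (i : Fin 3)
  | q (c : Clause) (j : Fin 8)

/-- The gadget matrix. -/
def M : Matrix (Fin 6) (Fin 8) ℕ :=
  !![1, 1, 1, 1, 0, 0, 0, 0;
     0, 0, 0, 0, 1, 1, 1, 1;
     1, 1, 0, 0, 1, 1, 0, 0;
     0, 0, 1, 1, 0, 0, 1, 1;
     1, 0, 1, 0, 1, 0, 1, 0;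
     0, 1, 0, 1, 0, 1, 0, 1]

/-- The vector `g^c = [x_1, x_1^c, x_2, x_2^c, x_3, x_3^c]` of vertices. -/
def g (c : Clause) : Fin 6 → Vertex :=
  ![.var (c.lit 0).var, .copy c 0, .var (c.lit 1).var, .copy c 1, .var (c.lit 2).var, .copy c 2]

/-- `V(I)`: the vertices of `f(I)`. -/
inductive IsVertex (I : Instance) : Vertex → Prop
  | hub (h : Hub) : IsVertex I (.hub h)
  | var (x : ℕ) (hx : x ∈ I.vars) : IsVertex I (.var x)
  | copy (c : Clause) (hc : c ∈ I.properClauses) (i : Fin 3) : IsVertex I (.copy c i)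
  | q (c : Clause) (hc : c ∈ I.properClauses) (j : Fin 8) : IsVertex I (.q c j)

/-- `E(I)`: the edges of `f(I)`, each in one orientation. -/
inductive IsEdge (I : Instance) : Vertex → Vertex → Prop
  | matrix (c : Clause) (hc : c ∈ I.properClauses) (i : Fin 6) (j : Fin 8) (h : M i j = 1) :
      IsEdge I (g c i) (.q c j)
  | positive (c : Clause) (hc : c ∈ I.properClauses) (i : Fin 3) (h : (c.lit i).pos = true) :
      IsEdge I (.copy c i) (.hub .u)
  | negative (c : Clause) (hc : c ∈ I.properClauses) (i : Fin 3) (h : (c.lit i).pos = false) :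
      IsEdge I (.copy c i) (.hub .v)
  | path (c : Clause) (hc : c ∈ I.properClauses) (j : Fin 7) :
      IsEdge I (.q c j.castSucc) (.q c j.succ)
  | var_u (x : ℕ) (hx : x ∈ I.vars) : IsEdge I (.var x) (.hub .u)
  | var_v (x : ℕ) (hx : x ∈ I.vars) : IsEdge I (.var x) (.hub .v)
  | hu_hu' : IsEdge I (.hub .hu) (.hub .hu')
  | hu'_u : IsEdge I (.hub .hu') (.hub .u)
  | u_v : IsEdge I (.hub .u) (.hub .v)
  | v_hv' : IsEdge I (.hub .v) (.hub .hv')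
  | hv'_hv : IsEdge I (.hub .hv') (.hub .hv)

/-- The vertex set `V(I)` of `f(I)`. -/
def vertexSet (I : Instance) : Set Vertex := {a | IsVertex I a}

/-- The graph `f(I) = (V(I), E(I))`. -/
def f (I : Instance) : SimpleGraph (vertexSet I) :=
  SimpleGraph.fromRel fun a b => IsEdge I a b

/-- Both ends of every edge in `E(I)` belong to `V(I)`, and they are distinct. -/
theorem IsEdge.isVertex {I : Instance} {a b : Vertex} (h : IsEdge I a b) :
    IsVertex I a ∧ IsVertex I b ∧ a ≠ b := by
  cases h with
  | matrix c hc i j h =>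
    refine ⟨?_, .q c hc j, ?_⟩
    · fin_cases i
      · exact .var _ ⟨c, hc.1, 0, rfl⟩
      · exact .copy c hc 0
      · exact .var _ ⟨c, hc.1, 1, rfl⟩
      · exact .copy c hc 1
      · exact .var _ ⟨c, hc.1, 2, rfl⟩
      · exact .copy c hc 2
    · fin_cases i <;> simp [g]
  | positive c hc i h => exact ⟨.copy c hc i, .hub _, by simp⟩
  | negative c hc i h => exact ⟨.copy c hc i, .hub _, by simp⟩
  | path c hc j => exact ⟨.q c hc _, .q c hc _, by simp [Fin.ext_iff]⟩
  | var_u x hx => exact ⟨.var x hx, .hub _, by simp⟩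
  | var_v x hx => exact ⟨.var x hx, .hub _, by simp⟩
  | _ => exact ⟨.hub _, .hub _, by simp⟩

/-! ## Strings for instances and for graphs -/

open Computability in
/-- A natural number in binary. -/
def encodeNat (n : ℕ) : List Γ' := encodingNatΓ'.encode n

open Computability in
/-- A literal: its sign, its variable in binary, and a comma. -/
def encodeLiteral (l : Literal) : List Γ' := .bit l.pos :: (encodeNat l.var ++ [.comma])

open Computability in
/-- A clause: its three literals between brackets. -/
def encodeClause (c : Clause) : List Γ' :=
  .bra :: (encodeLiteral (c.lit 0) ++ (encodeLiteral (c.lit 1) ++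
    (encodeLiteral (c.lit 2) ++ [.ket])))

open Computability in
/-- An instance of 3-SAT: its clauses one after the other. -/
def encodeInstance (I : Instance) : List Γ' := I.flatMap encodeClause

/-- Numbers for the hub vertices. -/
def Hub.index : Hub → ℕ
  | u => 0
  | v => 1
  | hu => 2
  | hu' => 3
  | hv => 4
  | hv' => 5

open Computability in
/-- The name of a vertex: a symbol for its kind, followed by its indices. -/
def encodeVertex : Vertex → List Γ'
  | .hub h => .blank :: encodeNat h.index
  | .var x => .comma :: encodeNat x
  | .copy c i => .ket :: (encodeNat i ++ encodeClause c)
  | .q c j => .bra :: (encodeNat j ++ encodeClause c)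

/-- A finite graph with vertex names in `α`, as data: the list of its vertices and the list of its
edges, each edge given by its two ends. As these lists stand for sets, repetitions are harmless. -/
structure GraphData (α : Type) where
  verts : List α
  edges : List (α × α)

/-- The lists in `D` list exactly the vertices and exactly the edges of the graph `G` on `V`. -/
def GraphData.Represents {α : Type} (D : GraphData α) {V : Set α} (G : SimpleGraph V) : Prop :=
  (∀ a, a ∈ D.verts ↔ a ∈ V) ∧
  (∀ e ∈ D.edges, e.1 ∈ V ∧ e.2 ∈ V) ∧
  ∀ a b : V, G.Adj a b ↔ ((a : α), (b : α)) ∈ D.edges ∨ ((b : α), (a : α)) ∈ D.edges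

/-- The alphabet for graphs: the letters of vertex names and two delimiters. -/
inductive GraphSymbol (Γ : Type) where
  | letter (s : Γ)
  | endName
  | endVerts

/-- The name of a vertex followed by a delimiter. -/
def encodeName {α Γ : Type} (enc : α → List Γ) (a : α) : List (GraphSymbol Γ) :=
  (enc a).map .letter ++ [.endName]

/-- The string for a graph: the names of all vertices, a delimiter, and then, for every edge, the
names of its two ends. -/
def GraphData.encode {α Γ : Type} (enc : α → List Γ) (D : GraphData α) : List (GraphSymbol Γ) :=
  D.verts.flatMap (encodeName enc) ++ .endVerts ::
    D.edges.flatMap fun e => encodeName enc e.1 ++ encodeName enc e.2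

/-! ### Different objects have different strings -/

theorem encodeNat_injective : Function.Injective encodeNat :=
  Computability.encodingNatΓ'.encode_injective

theorem append_cons_cancel {α : Type} {x y k l : List α} {s t : α} (hx : t ∉ x) (hy : s ∉ y)
    (h : x ++ s :: k = y ++ t :: l) : x = y ∧ k = l := by
  induction x generalizing y with
  | nil =>
    cases y with
    | nil => exact ⟨rfl, (List.cons.inj h).2⟩
    | cons b y => exact absurd (List.cons.inj h).1 fun e => hy (e ▸ List.mem_cons_self)
  | cons a x ih =>
    cases y with
    | nil => exact absurd (List.cons.inj h).1 fun e => hx (e ▸ List.mem_cons_self)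
    | cons b y =>
      simp only [List.cons_append, List.cons.injEq] at h
      simp only [List.mem_cons, not_or] at hx hy
      obtain ⟨h1, h2⟩ := ih hx.2 hy.2 h.2
      exact ⟨by rw [h.1, h1], h2⟩

theorem encodeNat_append {m n : ℕ} {s t : Computability.Γ'} {k l : List Computability.Γ'}
    (hs : ∀ b, s ≠ .bit b) (ht : ∀ b, t ≠ .bit b)
    (h : encodeNat m ++ s :: k = encodeNat n ++ t :: l) : m = n ∧ k = l := by
  have key : ∀ (s : Computability.Γ') (n : ℕ), (∀ b, s ≠ .bit b) → s ∉ encodeNat n := by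
    intro s n hs hm
    simp only [encodeNat, Computability.encodingNatΓ', List.mem_map] at hm
    obtain ⟨b, -, rfl⟩ := hm
    exact hs b rfl
  obtain ⟨h1, h2⟩ := append_cons_cancel (key t m ht) (key s n hs) h
  exact ⟨encodeNat_injective h1, h2⟩

theorem encodeLiteral_append {a b : Literal} {k l : List Computability.Γ'}
    (h : encodeLiteral a ++ k = encodeLiteral b ++ l) : a = b ∧ k = l := by
  obtain ⟨x, p⟩ := a
  obtain ⟨y, r⟩ := b
  simp only [encodeLiteral, List.cons_append, List.append_assoc, List.nil_append,
    List.cons.injEq, Computability.Γ'.bit.injEq] at h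
  obtain ⟨h1, h2⟩ := encodeNat_append (by simp) (by simp) h.2
  exact ⟨by rw [h.1, h1], h2⟩

theorem encodeClause_append {c d : Clause} {k l : List Computability.Γ'}
    (h : encodeClause c ++ k = encodeClause d ++ l) : c = d ∧ k = l := by
  simp only [encodeClause, List.cons_append, List.append_assoc, List.cons.injEq] at h
  obtain ⟨h0, h⟩ := encodeLiteral_append h.2
  obtain ⟨h1, h⟩ := encodeLiteral_append h
  obtain ⟨h2, h⟩ := encodeLiteral_append h
  refine ⟨?_, by simpa using h⟩
  obtain ⟨p, hp⟩ := c
  obtain ⟨r, hr⟩ := d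
  congr 1
  funext i
  fin_cases i
  exacts [h0, h1, h2]

theorem encodeInstance_injective : Function.Injective encodeInstance := by
  intro I
  induction I with
  | nil => rintro (_ | ⟨d, J⟩) h <;> simp_all [encodeInstance, encodeClause]
  | cons c I ih =>
    rintro (_ | ⟨d, J⟩) h
    · simp [encodeInstance, encodeClause] at h
    · simp only [encodeInstance, List.flatMap_cons] at h
      obtain ⟨h1, h2⟩ := encodeClause_append h
      rw [h1, ih h2]

theorem encodeVertex_injective : Function.Injective encodeVertex := by
  have key : ∀ {m n : ℕ} {c d : Clause},
      encodeNat m ++ encodeClause c = encodeNat n ++ encodeClause d → m = n ∧ c = d := by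
    intro m n c d h
    obtain ⟨h1, h2⟩ := encodeNat_append (by simp) (by simp) h
    exact ⟨h1, (encodeClause_append (k := []) (l := []) (by simp [encodeClause, h2])).1⟩
  intro a b h
  rcases a with h1 | x | ⟨c, i⟩ | ⟨c, j⟩ <;> rcases b with h2 | y | ⟨d, i'⟩ | ⟨d, j'⟩ <;>
    simp only [encodeVertex, List.cons.injEq, reduceCtorEq, false_and, true_and] at h
  · have := encodeNat_injective h
    cases h1 <;> cases h2 <;> simp_all [Hub.index]
  · rw [encodeNat_injective h]
  · obtain ⟨h1, h2⟩ := key h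
    rw [h2, Fin.ext h1]
  · obtain ⟨h1, h2⟩ := key h
    rw [h2, Fin.ext h1]

theorem encodeName_append {α Γ : Type} {enc : α → List Γ} (he : Function.Injective enc) {a b : α}
    {k l : List (GraphSymbol Γ)} (h : encodeName enc a ++ k = encodeName enc b ++ l) :
    a = b ∧ k = l := by
  simp only [encodeName, List.append_assoc, List.cons_append, List.nil_append] at h
  obtain ⟨h1, h2⟩ := append_cons_cancel (by simp) (by simp) h
  refine ⟨he (List.map_injective_iff.2 (fun x y hxy => ?_) h1), h2⟩
  simpa using hxy

theorem GraphData.encode_injective {α Γ : Type} {enc : α → List Γ} (he : Function.Injective enc) :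
    Function.Injective (GraphData.encode enc) := by
  have hne : ∀ a (k : List (GraphSymbol Γ)), encodeName enc a ++ k ≠ [] := by
    intro a k
    simp [encodeName]
  have hev : ∀ a (k l : List (GraphSymbol Γ)), encodeName enc a ++ k ≠ .endVerts :: l := by
    intro a k l h
    simp only [encodeName] at h
    rcases hx : enc a with _ | ⟨s, w⟩ <;> simp [hx] at h
  have edges : ∀ E F : List (α × α),
      E.flatMap (fun e => encodeName enc e.1 ++ encodeName enc e.2) =
        F.flatMap (fun e => encodeName enc e.1 ++ encodeName enc e.2) → E = F := by
    intro E
    induction E with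
    | nil =>
      rintro (_ | ⟨e, F⟩) h
      · rfl
      · simp only [List.flatMap_nil, List.flatMap_cons, List.append_assoc] at h
        exact absurd h.symm (hne _ _)
    | cons e E ih =>
      rintro (_ | ⟨e', F⟩) h
      · simp only [List.flatMap_nil, List.flatMap_cons, List.append_assoc] at h
        exact absurd h (hne _ _)
      · simp only [List.flatMap_cons, List.append_assoc] at h
        obtain ⟨h1, h⟩ := encodeName_append he h
        obtain ⟨h2, h⟩ := encodeName_append he h
        rw [ih F h, Prod.ext h1 h2]
  rintro ⟨V, E⟩ ⟨W, F⟩ h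
  simp only [GraphData.encode] at h
  induction V generalizing W with
  | nil =>
    cases W with
    | nil => simpa using edges _ _ (by simpa using h)
    | cons w W =>
      simp only [List.flatMap_nil, List.nil_append, List.flatMap_cons, List.append_assoc] at h
      exact absurd h.symm (hev _ _ _)
  | cons v V ih =>
    cases W with
    | nil =>
      simp only [List.flatMap_nil, List.nil_append, List.flatMap_cons, List.append_assoc] at h
      exact absurd h (hev _ _ _)
    | cons w W =>
      simp only [List.flatMap_cons, List.append_assoc] at h
      obtain ⟨h1, h⟩ := encodeName_append he h
      have := ih W h
      simp only [GraphData.mk.injEq] at this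
      rw [h1, this.1, this.2]

end TreeSpanner

/-! The equivalence. Given a satisfying assignment, build a tree around the edge `uv`: hang each
variable on `u` if it is true and on `v` if it is false, each copy on its only hub neighbour, and
all eight `q`-vertices of a clause below one true literal. The two rows of the gadget matrix for
this literal are complementary, so each `q`-vertex is adjacent to the variable or to its copy; as
the literal is true, both of these hang on the same side. Every vertex is within distance two of the
edge `uv`, so the diameter is at most 5. The stretch need only be checked on edges
(`dist_le_mul_dist`). The only edges with both ends at depth two join `q`-vertices of one clause,
which are on one side (`IsEdge.depth_add_depth_le`).

Conversely, in a spanning tree of diameter at most 5 the pendant paths at `u` and `v` force the edge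
`uv` and put every vertex outside the path at `u` within distance three of `u`, and likewise for
`v`. So each `q`-vertex has distance two from exactly one of `u`, `v`. Consecutive `q`-vertices on
different sides would have distance 5 in the tree, against the stretch 4; hence a clause chooses one
side (`exists_side`). The columns of the matrix realize all eight choices between `x_i` and `x_i^c`.
Take the column that chooses `x_i` when the sign of the literal agrees with the side, and the copy
otherwise. The tree neighbour of its `q`-vertex towards the side cannot be one of the chosen copies,
which are joined to the other hub only. So it is a variable hanging on the side that makes its
literal true, provided that "true" means adjacent to `u` in the tree. Tautological clauses hold
anyway.

Computability. A stack machine reads one clause at a time and keeps its string and its three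
variables on stacks. It compares the variables pairwise: literals being distinct, a clause is a
tautology exactly if two of its variables agree. It then copies these strings a bounded number of
times. Writing on a stack produces the output from its end to its beginning, so edges go directly to
the output stack, vertices to a second stack, and the latter is put on top at the end. Each name
costs time linear in the length of the clause, so the total time is linear (`reaches_output`). -/

namespace TreeSpanner

open Computability Turing

/-! ## A machine made of basic blocks -/

/-- Letters on the working stacks. -/
abbrev Letter := (GraphSymbol Γ' : Type)

/-- The working stacks. -/
inductive Stack where
  | out | verts | clause | var (i : Fin 3) | aux | left | right
  deriving DecidableEq, Fintype

/-- The alphabets of the input stack and of the working stacks. -/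
abbrev StackAlphabet : Option Stack → Type
  | none => Γ'
  | some _ => Letter

instance : Fintype Letter :=
  Fintype.ofEquiv (Option (Option Γ'))
    { toFun := fun s => match s with
        | none => .endVerts
        | some none => .endName
        | some (some s) => .letter s
      invFun := fun s => match s with
        | .endVerts => none
        | .endName => some none
        | .letter s => some (some s)
      left_inv := by rintro (_ | _ | _) <;> rfl
      right_inv := by rintro (_ | _ | _) <;> rfl }

instance : DecidableEq Letter := fun a b => by
  cases a <;> cases b <;> simp only [GraphSymbol.letter.injEq, reduceCtorEq] <;> infer_instance

/-- The finite control: two registers, the position inside the current clause, the signs of its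
literals, a flag for the current comparison, and a flag saying that all comparisons so far found
two different strings. -/
structure Control where
  reg : Option Letter
  reg' : Option Letter
  lit : Fin 3
  inVar : Bool
  sign : Fin 3 → Bool
  same : Bool
  proper : Bool

noncomputable instance : Fintype Control :=
  Fintype.ofInjective (fun v => (v.reg, v.reg', v.lit, v.inVar, v.sign, v.same, v.proper))
    (by rintro ⟨⟩ ⟨⟩ h; simpa using h)

/-- The control at the beginning, and between two clauses. -/
def Control.initial : Control := ⟨none, none, 0, false, fun _ => false, true, true⟩

/-- The control after a clause with given signs has been read. -/
def Control.loaded (s : Fin 3 → Bool) (p : Bool) : Control := ⟨none, none, 0, false, s, true, p⟩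

/-- The basic instructions. -/
inductive Instr where
  /-- Put the first or the second word on `d`, depending on the condition. -/
  | push (d : Stack) (p : Control → Bool) (l₁ l₂ : List Letter)
  /-- Empty the stack `a`, putting its letters on each of the stacks in `ds`. -/
  | move (a : Stack) (ds : List Stack)
  /-- Empty the stacks `a` and `b`, and clear the flag `proper` if they are equal. -/
  | compare (a b : Stack)

/-- The contents of all stacks. -/
abbrev Stacks : Type := ∀ k, List (StackAlphabet k)

/-- The effect of an instruction. -/
def Instr.eval : Instr → Control × Stacks → Control × Stacks
  | push d p l₁ l₂, (v, S) =>
    (v, Function.update S (some d) ((if p v then l₁ else l₂) ++ S (some d)))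
  | move a ds, (v, S) =>
    ({ v with reg := none }, fun k => match k with
      | none => S none
      | some k => if k = a then [] else
          if k ∈ ds then (S (some a)).reverse ++ S (some k) else S (some k))
  | compare a b, (v, S) =>
    ({ v with
        reg := none, reg' := none, same := true
        proper := v.proper && !(v.same && decide (S (some a) = S (some b))) },
      Function.update (Function.update S (some a) []) (some b) [])

/-- The number of steps for an instruction. -/
def Instr.time : Instr → Control × Stacks → ℕ
  | push _ _ _ _, _ => 1
  | move a _, s => (s.2 (some a)).length + 1
  | compare a b, s => max (s.2 (some a)).length (s.2 (some b)).length + 1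

/-- The conditions for an instruction to make sense. -/
def Instr.Valid : Instr → Prop
  | push _ _ _ _ => True
  | move a ds => a ∉ ds ∧ ds.Nodup
  | compare a b => a ≠ b

/-- The effect of a list of instructions. -/
def evalCode (l : List Instr) (s : Control × Stacks) : Control × Stacks :=
  l.foldl (fun s i => i.eval s) s

/-- The number of steps for a list of instructions. -/
def codeTime : List Instr → Control × Stacks → ℕ
  | [], _ => 0
  | i :: l, s => i.time s + codeTime l (i.eval s)

theorem evalCode_append (l l' : List Instr) (s : Control × Stacks) :
    evalCode (l ++ l') s = evalCode l' (evalCode l s) :=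
  List.foldl_append

theorem codeTime_append (l l' : List Instr) (s : Control × Stacks) :
    codeTime (l ++ l') s = codeTime l s + codeTime l' (evalCode l s) := by
  induction l generalizing s with
  | nil => simp [codeTime, evalCode]
  | cons i l ih => simp [codeTime, ih, evalCode, add_assoc]

/-! ### Instructions as machine statements, with step counts -/

section Statements

variable {Λ : Type}

/-- Put a word on a stack. -/
def pushWord (d : Stack) : List Letter → TM2.Stmt StackAlphabet Λ Control →
    TM2.Stmt StackAlphabet Λ Control
  | [], q => q
  | s :: l, q => pushWord d l (.push (some d) (fun _ => s) q)

theorem stepAux_pushWord (d : Stack) (l : List Letter) (q : TM2.Stmt StackAlphabet Λ Control)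
    (v : Control) (S : Stacks) :
    TM2.stepAux (pushWord d l q) v S =
      TM2.stepAux q v (Function.update S (some d) (l ++ S (some d))) := by
  induction l generalizing q with
  | nil => simp [pushWord]
  | cons s l ih => simp [pushWord, ih]

/-- Put the letter in the register on several stacks. -/
def pushReg : List Stack → TM2.Stmt StackAlphabet Λ Control → TM2.Stmt StackAlphabet Λ Control
  | [], q => q
  -- The default letter is never written: the programs get here only with a full register.
  | d :: ds, q => .push (some d) (fun v => v.reg.getD .endName) (pushReg ds q)

theorem stepAux_pushReg (ds : List Stack) (hd : ds.Nodup)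
    (q : TM2.Stmt StackAlphabet Λ Control) (v : Control) (S : Stacks) :
    TM2.stepAux (pushReg ds q) v S =
      TM2.stepAux q v (fun k => match k with
        | none => S none
        | some k => if k ∈ ds then v.reg.getD .endName :: S (some k) else S (some k)) := by
  induction ds generalizing S with
  | nil =>
    simp only [pushReg, List.not_mem_nil, if_false]
    congr 1
    funext k
    cases k <;> rfl
  | cons d ds ih =>
    obtain ⟨h1, h2⟩ := List.nodup_cons.1 hd
    simp only [pushReg, TM2.stepAux, ih h2]
    congr 1
    funext k
    rcases k with _ | k
    · simp
    · by_cases hk : k = d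
      · subst hk
        simp [h1]
      · simp [hk]

/-- The statement for an instruction at the label `self`, followed by the label `next`. -/
def Instr.stmt (self next : Λ) : Instr → TM2.Stmt StackAlphabet Λ Control
  | push d p l₁ l₂ =>
    .branch p (pushWord d l₁ (.goto fun _ => next)) (pushWord d l₂ (.goto fun _ => next))
  | move a ds =>
    .pop (some a) (fun v s => { v with reg := s }) <|
      .branch (fun v => v.reg.isSome) (pushReg ds (.goto fun _ => self)) (.goto fun _ => next)
  | compare a b =>
    .pop (some a) (fun v s => { v with reg := s }) <|
      .pop (some b) (fun v s => { v with reg' := s }) <|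
        .branch (fun v => v.reg.isNone && v.reg'.isNone)
          (.load (fun v => { v with proper := v.proper && !v.same, same := true })
            (.goto fun _ => next))
          (.load (fun v => { v with same := v.same && decide (v.reg = v.reg') })
            (.goto fun _ => self))

/-- The machine goes from one configuration to another one in at most `t` steps. -/
def Reaches (m : Λ → TM2.Stmt StackAlphabet Λ Control) (t : ℕ)
    (a b : TM2.Cfg StackAlphabet Λ Control) : Prop :=
  ∃ n ≤ t, (flip bind (TM2.step m))^[n] (some a) = some b

variable {m : Λ → TM2.Stmt StackAlphabet Λ Control}

theorem Reaches.refl (a : TM2.Cfg StackAlphabet Λ Control) : Reaches m 0 a a := ⟨0, le_rfl, rfl⟩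

theorem Reaches.trans {t t' : ℕ} {a b c : TM2.Cfg StackAlphabet Λ Control}
    (h : Reaches m t a b) (h' : Reaches m t' b c) : Reaches m (t + t') a c := by
  obtain ⟨n, hn, h⟩ := h
  obtain ⟨n', hn', h'⟩ := h'
  exact ⟨n' + n, by omega, by rw [Function.iterate_add_apply, h, h']⟩

theorem Reaches.mono {t t' : ℕ} {a b : TM2.Cfg StackAlphabet Λ Control}
    (h : Reaches m t a b) (ht : t ≤ t') : Reaches m t' a b := by
  obtain ⟨n, hn, h⟩ := h
  exact ⟨n, hn.trans ht, h⟩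

theorem reaches_one (l : Λ) (v : Control) (S : Stacks) :
    Reaches m 1 ⟨some l, v, S⟩ (TM2.stepAux (m l) v S) :=
  ⟨1, le_rfl, rfl⟩

/-- Each letter takes one round through the label `self`; the extra step discovers that the stack is
empty. Letters leave from the top, so they arrive in reverse order. -/
theorem reaches_move (self next : Λ) (a : Stack) (ds : List Stack) (ha : a ∉ ds) (hd : ds.Nodup)
    (hm : m self = (Instr.move a ds).stmt self next) (v : Control) (S : Stacks) (w : List Letter)
    (hw : S (some a) = w) :
    Reaches m (w.length + 1) ⟨some self, v, S⟩
      ⟨some next, ((Instr.move a ds).eval (v, S)).1, ((Instr.move a ds).eval (v, S)).2⟩ := by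
  induction w generalizing v S with
  | nil =>
    have h := reaches_one (m := m) self v S
    simp only [hm, Instr.stmt, TM2.stepAux, hw, List.head?_nil, Option.isSome_none, cond_false,
      List.tail_nil] at h
    simp only [List.length_nil, zero_add, Instr.eval]
    convert! h using 2
    funext k
    rcases k with _ | k
    · simp
    · by_cases hk : k = a
      · subst hk
        simp
      · simp [hk, hw]
  | cons s w ih =>
    have h := reaches_one (m := m) self v S
    simp only [hm, Instr.stmt, TM2.stepAux, hw, List.head?_cons, Option.isSome_some, cond_true,
      List.tail_cons, stepAux_pushReg _ hd] at h
    have h2 := h.trans (ih _ _ (by simp [ha]))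
    rw [List.length_cons, add_comm]
    convert! h2 using 2
    simp only [Instr.eval]
    funext k
    rcases k with _ | k
    · simp
    · by_cases hk : k = a
      · simp [hk]
      · by_cases hk' : k ∈ ds <;> simp [hk, hk', hw, ha]

/-- Both stacks are popped in parallel until both are empty. If one is exhausted earlier, its
register is `none` while the other is not, and this counts as a difference; hence words of different
lengths are told apart, and the longer word determines the time. -/
theorem reaches_compare (self next : Λ) (a b : Stack) (hab : a ≠ b)
    (hm : m self = (Instr.compare a b).stmt self next) (v : Control) (S : Stacks)
    (w w' : List Letter) (hw : S (some a) = w) (hw' : S (some b) = w') :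
    Reaches m (max w.length w'.length + 1) ⟨some self, v, S⟩
      ⟨some next, ((Instr.compare a b).eval (v, S)).1, ((Instr.compare a b).eval (v, S)).2⟩ := by
  have hab' : (some b : Option Stack) ≠ some a := by simpa using hab.symm
  induction hn : max w.length w'.length generalizing v S w w' with
  | zero =>
    have h1 : w = [] := List.length_eq_zero_iff.1 (by omega)
    have h2 : w' = [] := List.length_eq_zero_iff.1 (by omega)
    subst h1 h2
    have h := reaches_one (m := m) self v S
    rw [hm] at h
    simp only [Instr.stmt, TM2.stepAux, hw, hw', List.head?_nil, Option.isNone_none, cond_true,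
      List.tail_nil, Bool.and_self, Function.update_of_ne hab'] at h
    simpa [Instr.eval, hw, hw'] using h
  | succ n ih =>
    have h := reaches_one (m := m) self v S
    rw [hm] at h
    have hne : (w.head?.isNone && w'.head?.isNone) = false := by
      rcases w with _ | ⟨s, w⟩ <;> rcases w' with _ | ⟨s', w'⟩ <;> simp_all
    simp only [Instr.stmt, TM2.stepAux, hw, hw', hne, cond_false,
      Function.update_of_ne hab'] at h
    have h2 := h.trans (ih _ _ w.tail w'.tail (by simp [hab]) (by simp)
      (by simp only [List.length_tail]; omega))
    rw [add_comm] at h2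
    convert! h2 using 2
    · simp only [Instr.eval]
      congr 2
      rw [Bool.and_assoc]
      congr 1
      rcases w with _ | ⟨s, w⟩ <;> rcases w' with _ | ⟨s', w'⟩ <;> simp_all [eq_comm]
    · simp only [Instr.eval]
      funext k
      by_cases h1 : k = some b
      · subst h1; simp
      · by_cases h2 : k = some a
        · subst h2; simp [h1]
        · simp [h1, h2]

theorem Instr.reaches (i : Instr) (hi : i.Valid) (self next : Λ)
    (hm : m self = i.stmt self next) (s : Control × Stacks) :
    Reaches m (i.time s) ⟨some self, s.1, s.2⟩ ⟨some next, (i.eval s).1, (i.eval s).2⟩ := by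
  obtain ⟨v, S⟩ := s
  cases i with
  | push d p l₁ l₂ =>
    have h := reaches_one (m := m) self v S
    simp only [hm, Instr.stmt, TM2.stepAux, stepAux_pushWord] at h
    cases hp : p v <;> simpa [Instr.eval, hp, Instr.time] using h
  | move a ds => exact reaches_move self next a ds hi.1 hi.2 hm v S _ rfl
  | compare a b => exact reaches_compare self next a b hi hm v S _ _ rfl rfl

end Statements

/-! ## Vertex templates -/

/-- Vertices of the graph in terms of the current clause; `side i` is the hub vertex which is
adjacent to `copy i`. -/
inductive Template where
  | hub (h : Hub) | var (i : Fin 3) | copy (i : Fin 3) | q (j : Fin 8) | side (i : Fin 3)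

/-- The vertex for a template. -/
def Template.vertex (c : Clause) : Template → Vertex
  | hub h => .hub h
  | var i => .var (c.lit i).var
  | copy i => .copy c i
  | q j => .q c j
  | side i => .hub (if (c.lit i).pos then .u else .v)

/-- Put the word on `d` that consists of `l`, the reverse of the word on `a`, and a delimiter. -/
def copyCode (d a : Stack) (l : List Γ') : List Instr :=
  [.push d (fun _ => true) [.endName] [], .move a [.aux, d], .move .aux [a],
    .push d (fun _ => true) (l.map .letter) []]

/-- Put the name of the vertex for a template on `d`. -/
def Template.code (d : Stack) : Template → List Instr
  | hub h => [.push d (fun _ => true) (encodeName encodeVertex (.hub h)) []]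
  | var i => copyCode d (.var i) [.comma]
  | copy i => copyCode d .clause (.ket :: encodeNat i)
  | q j => copyCode d .clause (.bra :: encodeNat j)
  | side i => [.push d (fun v => v.sign i) (encodeName encodeVertex (.hub .u))
      (encodeName encodeVertex (.hub .v))]

/-- Put the names of the vertices for a list of templates on `d`. -/
def templatesCode (d : Stack) (l : List Template) : List Instr := l.reverse.flatMap (·.code d)

/-- Empty the stacks with the clause and its variables. -/
def clearCode : List Instr :=
  [.move .clause [], .move (.var 0) [], .move (.var 1) [], .move (.var 2) []]

/-- Compare two variables. -/
def compareCode (i j : Fin 3) : List Instr :=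
  [.move (.var i) [.aux, .left], .move .aux [.var i], .move (.var j) [.aux, .right],
    .move .aux [.var j], .compare .left .right]

/-- Contents of the stacks between the main stages of the computation. -/
def contents (inp : List Γ') (out verts clause : List Letter) (var : Fin 3 → List Letter) : Stacks
  | none => inp
  | some .out => out
  | some .verts => verts
  | some .clause => clause
  | some (.var i) => var i
  | some .aux | some .left | some .right => []

/-- The word on the clause stack. -/
def clauseWord (c : Clause) : List Letter := ((encodeClause c).map .letter).reverse

/-- The words on the variable stacks. -/
def varWord (c : Clause) (i : Fin 3) : List Letter :=
  ((encodeNat (c.lit i).var).map .letter).reverse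

/-- The state after a clause has been read. -/
def loadedState (c : Clause) (p : Bool) (inp : List Γ') (out verts : List Letter) :
    Control × Stacks :=
  (.loaded (fun i => (c.lit i).pos) p, contents inp out verts (clauseWord c) (varWord c))

section Update

variable (inp : List Γ') (out verts clause : List Letter) (var : Fin 3 → List Letter)

theorem update_contents_none (w : List Γ') :
    Function.update (contents inp out verts clause var) none w =
      contents w out verts clause var := by
  funext k
  rcases k with _ | _ | _ | _ | _ | _ | _ | _ <;> rfl

theorem update_contents_out (w : List Letter) :
    Function.update (contents inp out verts clause var) (some .out) w =
      contents inp w verts clause var := by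
  funext k
  rcases k with _ | _ | _ | _ | _ | _ | _ | _ <;> rfl

theorem update_contents_verts (w : List Letter) :
    Function.update (contents inp out verts clause var) (some .verts) w =
      contents inp out w clause var := by
  funext k
  rcases k with _ | _ | _ | _ | _ | _ | _ | _ <;> rfl

theorem update_contents_clause (w : List Letter) :
    Function.update (contents inp out verts clause var) (some .clause) w =
      contents inp out verts w var := by
  funext k
  rcases k with _ | _ | _ | _ | _ | _ | _ | _ <;> rfl

theorem update_contents_var (i : Fin 3) (w : List Letter) :
    Function.update (contents inp out verts clause var) (some (.var i)) w =
      contents inp out verts clause (Function.update var i w) := by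
  funext k
  rcases k with _ | _ | _ | _ | j | _ | _ | _ <;> try rfl
  by_cases h : j = i
  · subst h; simp [contents]
  · simp [contents, h]

end Update

/-! ### Effect and cost of the instruction lists on a loaded clause -/

theorem varWord_length_le (c : Clause) (i : Fin 3) :
    (varWord c i).length ≤ (encodeClause c).length := by
  fin_cases i <;> simp [varWord, encodeClause, encodeLiteral] <;> omega

theorem clauseWord_length (c : Clause) : (clauseWord c).length = (encodeClause c).length := by
  simp [clauseWord]

/-- The clause is stored reversed, as it was read. One move reverses it, so that it appears
correctly on the target and on `aux`; moving `aux` back restores the original. The delimiter is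
pushed first because it ends the name. -/
theorem evalCode_copyCode_clause_out (l : List Γ') (c : Clause) (p : Bool) (inp : List Γ')
    (out verts : List Letter) :
    evalCode (copyCode .out .clause l) (loadedState c p inp out verts) =
      loadedState c p inp ((l ++ encodeClause c).map .letter ++ .endName :: out) verts := by
  simp only [evalCode, copyCode, List.foldl, Instr.eval, loadedState, Prod.mk.injEq]
  refine ⟨rfl, ?_⟩
  funext k
  rcases k with _ | _ | _ | _ | _ | _ | _ | _ <;> simp [contents, clauseWord]

theorem evalCode_copyCode_clause_verts (l : List Γ') (c : Clause) (p : Bool) (inp : List Γ')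
    (out verts : List Letter) :
    evalCode (copyCode .verts .clause l) (loadedState c p inp out verts) =
      loadedState c p inp out ((l ++ encodeClause c).map .letter ++ .endName :: verts) := by
  simp only [evalCode, copyCode, List.foldl, Instr.eval, loadedState, Prod.mk.injEq]
  refine ⟨rfl, ?_⟩
  funext k
  rcases k with _ | _ | _ | _ | _ | _ | _ | _ <;> simp [contents, clauseWord]

theorem evalCode_copyCode_var_out (i : Fin 3) (l : List Γ') (c : Clause) (p : Bool)
    (inp : List Γ') (out verts : List Letter) :
    evalCode (copyCode .out (.var i) l) (loadedState c p inp out verts) =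
      loadedState c p inp
        ((l ++ encodeNat (c.lit i).var).map .letter ++ .endName :: out) verts := by
  simp only [evalCode, copyCode, List.foldl, Instr.eval, loadedState, Prod.mk.injEq]
  refine ⟨rfl, ?_⟩
  funext k
  rcases k with _ | _ | _ | _ | j | _ | _ | _ <;> simp [contents, varWord]
  by_cases h : j = i
  · subst h; simp
  · simp [h]

theorem evalCode_copyCode_var_verts (i : Fin 3) (l : List Γ') (c : Clause) (p : Bool)
    (inp : List Γ') (out verts : List Letter) :
    evalCode (copyCode .verts (.var i) l) (loadedState c p inp out verts) =
      loadedState c p inp out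
        ((l ++ encodeNat (c.lit i).var).map .letter ++ .endName :: verts) := by
  simp only [evalCode, copyCode, List.foldl, Instr.eval, loadedState, Prod.mk.injEq]
  refine ⟨rfl, ?_⟩
  funext k
  rcases k with _ | _ | _ | _ | j | _ | _ | _ <;> simp [contents, varWord]
  by_cases h : j = i
  · subst h; simp
  · simp [h]

theorem Template.evalCode_out (t : Template) (c : Clause) (p : Bool) (inp : List Γ')
    (out verts : List Letter) :
    evalCode (t.code .out) (loadedState c p inp out verts) =
      loadedState c p inp (encodeName encodeVertex (t.vertex c) ++ out) verts := by
  cases t with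
  | hub h => simp [Template.code, evalCode, Instr.eval, loadedState, update_contents_out, vertex,
      contents]
  | var i => simp [Template.code, evalCode_copyCode_var_out, vertex, encodeName, encodeVertex]
  | copy i => simp [Template.code, evalCode_copyCode_clause_out, vertex, encodeName, encodeVertex]
  | q i => simp [Template.code, evalCode_copyCode_clause_out, vertex, encodeName, encodeVertex]
  | side i =>
    cases h : (c.lit i).pos <;>
      simp [Template.code, evalCode, Instr.eval, loadedState, update_contents_out, vertex,
        contents, Control.loaded, h]

theorem Template.evalCode_verts (t : Template) (c : Clause) (p : Bool) (inp : List Γ')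
    (out verts : List Letter) :
    evalCode (t.code .verts) (loadedState c p inp out verts) =
      loadedState c p inp out (encodeName encodeVertex (t.vertex c) ++ verts) := by
  cases t with
  | hub h => simp [Template.code, evalCode, Instr.eval, loadedState, update_contents_verts, vertex,
      contents]
  | var i => simp [Template.code, evalCode_copyCode_var_verts, vertex, encodeName, encodeVertex]
  | copy i => simp [Template.code, evalCode_copyCode_clause_verts, vertex, encodeName, encodeVertex]
  | q i => simp [Template.code, evalCode_copyCode_clause_verts, vertex, encodeName, encodeVertex]
  | side i =>
    cases h : (c.lit i).pos <;>
      simp [Template.code, evalCode, Instr.eval, loadedState, update_contents_verts, vertex,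
        contents, Control.loaded, h]

theorem Template.codeTime_le (t : Template) (d : Stack) (hd : d = .out ∨ d = .verts) (c : Clause)
    (p : Bool) (inp : List Γ') (out verts : List Letter) :
    codeTime (t.code d) (loadedState c p inp out verts) ≤ 2 * (encodeClause c).length + 4 := by
  have h1 := clauseWord_length c
  have h2 := varWord_length_le c
  rcases hd with rfl | rfl <;> cases t with
  | hub h => simp [Template.code, codeTime, Instr.time]
  | side i => simp [Template.code, codeTime, Instr.time]
  | var i =>
    have := h2 i
    simp [Template.code, copyCode, codeTime, Instr.time, Instr.eval, loadedState, contents]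
    omega
  | _ =>
    simp [Template.code, copyCode, codeTime, Instr.time, Instr.eval, loadedState, contents]
    omega

theorem evalCode_templatesCode_out (l : List Template) (c : Clause) (p : Bool) (inp : List Γ')
    (out verts : List Letter) :
    evalCode (templatesCode .out l) (loadedState c p inp out verts) =
      loadedState c p inp (l.flatMap (fun t => encodeName encodeVertex (t.vertex c)) ++ out)
        verts := by
  induction l with
  | nil => rfl
  | cons t l ih =>
    simp only [templatesCode, List.reverse_cons, List.flatMap_append, evalCode_append,
      List.flatMap_singleton] at ih ⊢
    rw [ih, Template.evalCode_out]
    simp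

theorem evalCode_templatesCode_verts (l : List Template) (c : Clause) (p : Bool) (inp : List Γ')
    (out verts : List Letter) :
    evalCode (templatesCode .verts l) (loadedState c p inp out verts) =
      loadedState c p inp out
        (l.flatMap (fun t => encodeName encodeVertex (t.vertex c)) ++ verts) := by
  induction l with
  | nil => rfl
  | cons t l ih =>
    simp only [templatesCode, List.reverse_cons, List.flatMap_append, evalCode_append,
      List.flatMap_singleton] at ih ⊢
    rw [ih, Template.evalCode_verts]
    simp

theorem codeTime_templatesCode_le (l : List Template) (d : Stack) (hd : d = .out ∨ d = .verts)
    (c : Clause) (p : Bool) (inp : List Γ') (out verts : List Letter) :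
    codeTime (templatesCode d l) (loadedState c p inp out verts) ≤
      l.length * (2 * (encodeClause c).length + 4) := by
  induction l with
  | nil => simp [templatesCode, codeTime]
  | cons t l ih =>
    have h : ∃ out' verts', evalCode (templatesCode d l) (loadedState c p inp out verts) =
        loadedState c p inp out' verts' := by
      rcases hd with rfl | rfl
      · exact ⟨_, _, evalCode_templatesCode_out ..⟩
      · exact ⟨_, _, evalCode_templatesCode_verts ..⟩
    obtain ⟨out', verts', h⟩ := h
    have h' := t.codeTime_le d hd c p inp out' verts'
    simp only [templatesCode, List.reverse_cons, List.flatMap_append, codeTime_append,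
      List.flatMap_singleton] at ih h ⊢
    rw [h, List.length_cons, add_mul, one_mul]
    -- The codes run in reverse order, so the cost of the head `t` is added after that of `l`.
    omega

theorem evalCode_compareCode (i j : Fin 3) (hij : i ≠ j) (c : Clause) (p : Bool) (inp : List Γ')
    (out verts : List Letter) :
    evalCode (compareCode i j) (loadedState c p inp out verts) =
      loadedState c (p && decide ((c.lit i).var ≠ (c.lit j).var)) inp out verts := by
  -- Comparing strings decides equality of variables because the binary encoding is injective.
  have h : varWord c i = varWord c j ↔ (c.lit i).var = (c.lit j).var := by
    simp only [varWord, List.reverse_inj]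
    rw [(List.map_injective_iff.2 fun x y hxy => by simpa using hxy).eq_iff,
      encodeNat_injective.eq_iff]
  simp only [evalCode, compareCode, List.foldl, Instr.eval, loadedState, Prod.mk.injEq]
  refine ⟨?_, ?_⟩
  · simp [Control.loaded, contents, hij.symm, h]
  · funext k
    rcases k with _ | _ | _ | _ | k | _ | _ | _ <;> simp [contents]
    by_cases h1 : k = i
    · subst h1; simp [hij]
    · by_cases h2 : k = j
      · subst h2; simp [h1]
      · simp [h1, h2]

theorem codeTime_compareCode_le (i j : Fin 3) (hij : i ≠ j) (c : Clause) (p : Bool)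
    (inp : List Γ') (out verts : List Letter) :
    codeTime (compareCode i j) (loadedState c p inp out verts) ≤
      5 * (encodeClause c).length + 5 := by
  have h2 := varWord_length_le c i
  have h3 := varWord_length_le c j
  simp [compareCode, codeTime, Instr.time, Instr.eval, loadedState, contents, hij.symm]
  omega

theorem evalCode_clearCode (c : Clause) (p : Bool) (inp : List Γ') (out verts : List Letter) :
    evalCode clearCode (loadedState c p inp out verts) =
      (.loaded (fun i => (c.lit i).pos) p, contents inp out verts [] fun _ => []) := by
  simp only [evalCode, clearCode, List.foldl, Instr.eval, loadedState, Prod.mk.injEq]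
  refine ⟨rfl, ?_⟩
  funext k
  rcases k with _ | _ | _ | _ | k | _ | _ | _ <;> simp [contents]
  fin_cases k <;> simp

theorem codeTime_clearCode_le (c : Clause) (p : Bool) (inp : List Γ') (out verts : List Letter) :
    codeTime clearCode (loadedState c p inp out verts) ≤ 4 * (encodeClause c).length + 4 := by
  have h1 := clauseWord_length c
  have h2 := varWord_length_le c
  have h3 := h2 0
  have h4 := h2 1
  have h5 := h2 2
  simp [clearCode, codeTime, Instr.time, Instr.eval, loadedState, contents]
  omega

/-! ## The machine -/

/-- Edges as one list of ends. -/
def ends (l : List (Template × Template)) : List Template := l.flatMap fun e => [e.1, e.2]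

/-- The hub vertices. -/
def hubVertices : List Template :=
  [.hub .u, .hub .v, .hub .hu, .hub .hu', .hub .hv, .hub .hv']

/-- The edges between hub vertices. -/
def hubEdges : List (Template × Template) :=
  [(.hub .hu, .hub .hu'), (.hub .hu', .hub .u), (.hub .u, .hub .v), (.hub .v, .hub .hv'),
    (.hub .hv', .hub .hv)]

/-- The variables of a clause. -/
def varVertices : List Template := (List.finRange 3).map .var

/-- The edges at the variables of a clause which are present even if the clause is a tautology. -/
def varEdges : List (Template × Template) :=
  (List.finRange 3).flatMap fun i => [(.var i, .hub .u), (.var i, .hub .v)]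

/-- The vertices for a clause that is not a tautology. -/
def clauseVertices : List Template :=
  (List.finRange 3).map .copy ++ (List.finRange 8).map .q

/-- The vector `g` of templates. -/
def gTemplate : Fin 6 → Template := ![.var 0, .copy 0, .var 1, .copy 1, .var 2, .copy 2]

/-- The edges for a clause that is not a tautology. -/
def clauseEdges : List (Template × Template) :=
  ((List.finRange 6).flatMap fun i =>
      ((List.finRange 8).filter fun j => decide (M i j = 1)).map fun j => (gTemplate i, .q j)) ++
    ((List.finRange 3).map fun i => (.copy i, .side i)) ++
    (List.finRange 7).map fun j => (.q j.castSucc, .q j.succ)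

/-- Put the names of the vertices and of the ends of edges for the templates on the stacks. -/
def emitCode (l : List Template) (es : List (Template × Template)) : List Instr :=
  templatesCode .verts l ++ templatesCode .out (ends es)

/-- The word for some vertices. -/
def vertsWord (c : Clause) (l : List Template) : List Letter :=
  l.flatMap fun t => encodeName encodeVertex (t.vertex c)

theorem evalCode_emitCode (l : List Template) (l' : List (Template × Template)) (c : Clause)
    (p : Bool) (inp : List Γ') (out verts : List Letter) :
    evalCode (emitCode l l') (loadedState c p inp out verts) =
      loadedState c p inp (vertsWord c (ends l') ++ out) (vertsWord c l ++ verts) := by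
  rw [emitCode, evalCode_append, evalCode_templatesCode_verts, evalCode_templatesCode_out]
  rfl

theorem codeTime_emitCode_le (l : List Template) (l' : List (Template × Template)) (c : Clause)
    (p : Bool) (inp : List Γ') (out verts : List Letter) :
    codeTime (emitCode l l') (loadedState c p inp out verts) ≤
      (l.length + (ends l').length) * (2 * (encodeClause c).length + 4) := by
  rw [emitCode, codeTime_append, evalCode_templatesCode_verts, add_mul]
  exact add_le_add (codeTime_templatesCode_le _ _ (.inr rfl) ..)
    (codeTime_templatesCode_le _ _ (.inl rfl) ..)

/-- The names of the basic blocks. -/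
inductive Block where
  | start | read | vars | clause | clear | finish
  deriving DecidableEq

instance : Fintype Block where
  elems := {.start, .read, .vars, .clause, .clear, .finish}
  complete := by rintro ⟨⟩ <;> simp

/-- The word for some templates of hub vertices. -/
def hubWord (l : List Template) : List Letter :=
  l.flatMap fun t => match t with
    | .hub h => encodeName encodeVertex (.hub h)
    | _ => []

/-- The instructions of the basic blocks. -/
def Block.code : Block → List Instr
  | start => [.push .verts (fun _ => true) (hubWord hubVertices) [],
      .push .out (fun _ => true) (hubWord (ends hubEdges)) []]
  | read => []
  | vars => emitCode varVertices varEdges ++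
      (compareCode 0 1 ++ (compareCode 0 2 ++ compareCode 1 2))
  | clause => emitCode clauseVertices clauseEdges
  | clear => clearCode
  | finish => [.move .verts [.aux], .push .out (fun _ => true) [.endVerts] [], .move .aux [.out]]

/-- The labels of the machine. -/
abbrev Label : Type := Σ b : Block, Fin (b.code.length + 1)

/-- The label at the beginning of a block. -/
def Block.entry (b : Block) : Label := ⟨b, 0⟩

/-- The change of control after a letter of the input has been read. -/
def Control.afterLetter (v : Control) : Control :=
  match v.reg with
  | some (.letter (.bit b)) =>
    if v.inVar then { v with reg := none }
    else { v with reg := none, inVar := true, sign := Function.update v.sign v.lit b }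
  | some (.letter .comma) => { v with reg := none, inVar := false, lit := v.lit + 1 }
  | _ => { v with reg := none }

/-- The letter in the register is a binary digit of a variable. -/
def Control.isDigit (v : Control) : Bool :=
  match v.reg with
  | some (.letter (.bit _)) => v.inVar
  | _ => false

/-- Put the letter in the register on the stack of the current variable. -/
def pushVar (q : TM2.Stmt StackAlphabet Label Control) : TM2.Stmt StackAlphabet Label Control :=
  .branch (fun v => decide (v.lit = 0)) (pushReg [.var 0] q) <|
    .branch (fun v => decide (v.lit = 1)) (pushReg [.var 1] q) (pushReg [.var 2] q)

/-- Read a letter of the input. -/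
def readStmt : TM2.Stmt StackAlphabet Label Control :=
  .pop none (fun v s => { v with reg := s.map .letter }) <|
    .branch (fun v => v.reg.isNone) (.goto fun _ => Block.finish.entry) <|
      pushReg [.clause] <|
        .branch Control.isDigit
          (pushVar (.load Control.afterLetter (.goto fun _ => Block.read.entry))) <|
          .branch (fun v => decide (v.reg = some (.letter .ket)))
            (.load Control.afterLetter (.goto fun _ => Block.vars.entry))
            (.load Control.afterLetter (.goto fun _ => Block.read.entry))

/-- The statements at the ends of the basic blocks. -/
def Block.exit : Block → TM2.Stmt StackAlphabet Label Control
  | start => .goto fun _ => read.entry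
  | read => readStmt
  | vars => .goto fun v => if v.proper then clause.entry else clear.entry
  | clause => .goto fun _ => clear.entry
  | clear => .load (fun v => { v with proper := true }) (.goto fun _ => read.entry)
  | finish => .load (fun _ => .initial) .halt

/-- The program of the machine. -/
def program (l : Label) : TM2.Stmt StackAlphabet Label Control :=
  if h : l.2.1 < l.1.code.length then
    (l.1.code[l.2.1]).stmt l ⟨l.1, ⟨l.2.1 + 1, by omega⟩⟩
  else l.1.exit

/-- Induction on the number `n` of instructions still to be executed. The last label of a block
carries no instruction; it is reserved for the exit statement. -/
theorem reaches_code (b : Block) (hb : ∀ i ∈ b.code, i.Valid) (n k : ℕ)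
    (h : k + n = b.code.length) (s : Control × Stacks) :
    Reaches program (codeTime (b.code.drop k) s) ⟨some ⟨b, ⟨k, by omega⟩⟩, s.1, s.2⟩
      ⟨some ⟨b, ⟨b.code.length, by omega⟩⟩, (evalCode (b.code.drop k) s).1,
        (evalCode (b.code.drop k) s).2⟩ := by
  induction n generalizing k s with
  | zero =>
    obtain rfl : k = b.code.length := by omega
    simpa [codeTime, evalCode] using Reaches.refl _
  | succ n ih =>
    have hk : k < b.code.length := by omega
    rw [List.drop_eq_getElem_cons hk]
    refine (Instr.reaches b.code[k] (hb _ (List.getElem_mem hk)) _ ⟨b, ⟨k + 1, by omega⟩⟩ ?_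
      s).trans (ih (k + 1) (by omega) _)
    simp [program, hk]

theorem reaches_block (b : Block) (hb : ∀ i ∈ b.code, i.Valid) (s : Control × Stacks) :
    Reaches program (codeTime b.code s + 1) ⟨some b.entry, s.1, s.2⟩
      (TM2.stepAux b.exit (evalCode b.code s).1 (evalCode b.code s).2) := by
  have h := (reaches_code b hb b.code.length 0 (by omega) s).trans (reaches_one _ _ _)
  simpa [program, Block.entry] using h

theorem copyCode_valid (d a : Stack) (l : List Γ') (h : d ≠ a) (hd : d ≠ .aux) (ha : a ≠ .aux) :
    ∀ i ∈ copyCode d a l, i.Valid := by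
  simp [copyCode, Instr.Valid, ha, h.symm, hd.symm, ha.symm]

theorem Template.code_valid (t : Template) (d : Stack) (hd : d = .out ∨ d = .verts) :
    ∀ i ∈ t.code d, i.Valid := by
  rcases hd with rfl | rfl <;> cases t <;>
    first
    | exact copyCode_valid _ _ _ (by simp) (by simp) (by simp)
    | simp [Template.code, Instr.Valid]

theorem emitCode_valid (l : List Template) (l' : List (Template × Template)) :
    ∀ i ∈ emitCode l l', i.Valid := by
  simp only [emitCode, templatesCode, List.mem_append, List.mem_flatMap]
  rintro i (⟨t, -, ht⟩ | ⟨t, -, ht⟩)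
  · exact t.code_valid _ (.inr rfl) i ht
  · exact t.code_valid _ (.inl rfl) i ht

theorem compareCode_valid (i j : Fin 3) : ∀ k ∈ compareCode i j, k.Valid := by
  simp [compareCode, Instr.Valid]

theorem Block.code_valid (b : Block) : ∀ i ∈ b.code, i.Valid := by
  cases b with
  | vars =>
    simp only [Block.code, List.mem_append]
    rintro i (h | h | h | h)
    exacts [emitCode_valid _ _ i h, compareCode_valid _ _ i h, compareCode_valid _ _ i h,
      compareCode_valid _ _ i h]
  | clause => exact emitCode_valid _ _
  | _ => simp [Block.code, clearCode, Instr.Valid]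

/-! ### Reading a clause -/

section Read

variable (v : Control) (inp : List Γ') (out verts clause : List Letter)
  (var : Fin 3 → List Letter)

theorem pushReg_contents_clause (q : TM2.Stmt StackAlphabet Label Control) :
    TM2.stepAux (pushReg [.clause] q) v (contents inp out verts clause var) =
      TM2.stepAux q v (contents inp out verts (v.reg.getD .endName :: clause) var) := by
  simp only [pushReg, TM2.stepAux, update_contents_clause]
  rfl

theorem pushReg_contents_var (i : Fin 3) (q : TM2.Stmt StackAlphabet Label Control) :
    TM2.stepAux (pushReg [.var i] q) v (contents inp out verts clause var) =
      TM2.stepAux q v (contents inp out verts clause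
        (Function.update var i (v.reg.getD .endName :: var i))) := by
  simp only [pushReg, TM2.stepAux, update_contents_var]
  rfl

theorem pushVar_contents (q : TM2.Stmt StackAlphabet Label Control) :
    TM2.stepAux (pushVar q) v (contents inp out verts clause var) =
      TM2.stepAux q v (contents inp out verts clause
        (Function.update var v.lit (v.reg.getD .endName :: var v.lit))) := by
  simp only [pushVar, TM2.stepAux, pushReg_contents_var]
  generalize hi : v.lit = i
  fin_cases i <;> simp

theorem reaches_read (s : Γ') (h : ({ v with reg := some (.letter s) } : Control).isDigit = false) :
    Reaches program 1 ⟨some Block.read.entry, v, contents (s :: inp) out verts clause var⟩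
      ⟨some (if s = .ket then Block.vars.entry else Block.read.entry),
        ({ v with reg := some (.letter s) } : Control).afterLetter,
        contents inp out verts (.letter s :: clause) var⟩ := by
  -- The block `read` has no instructions, so its exit statement is the whole step.
  have h1 := reaches_block .read (Block.code_valid _)
    (v, contents (s :: inp) out verts clause var)
  simp only [Block.code, codeTime, evalCode, List.foldl_nil, Block.exit, readStmt, TM2.stepAux,
    update_contents_none] at h1
  have e : contents (s :: inp) out verts clause var none = s :: inp := rfl
  rw [e] at h1
  simp only [List.head?_cons, Option.map_some, Option.isNone_some, cond_false, List.tail_cons,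
    pushReg_contents_clause, TM2.stepAux, h, Option.getD_some, Option.some.injEq,
    GraphSymbol.letter.injEq] at h1
  by_cases hs : s = .ket <;> simpa [hs] using h1

theorem reaches_read_digit (b : Bool) (hv' : v.inVar = true) :
    Reaches program 1 ⟨some Block.read.entry, v, contents (.bit b :: inp) out verts clause var⟩
      ⟨some Block.read.entry, { v with reg := none },
        contents inp out verts (.letter (.bit b) :: clause)
          (Function.update var v.lit (.letter (.bit b) :: var v.lit))⟩ := by
  have h1 := reaches_block .read (Block.code_valid _)
    (v, contents (.bit b :: inp) out verts clause var)
  simp only [Block.code, codeTime, evalCode, List.foldl_nil, Block.exit, readStmt, TM2.stepAux,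
    update_contents_none] at h1
  have e : contents (.bit b :: inp) out verts clause var none = .bit b :: inp := rfl
  rw [e] at h1
  simpa only [List.head?_cons, Option.map_some, Option.isNone_some, cond_false, List.tail_cons,
    pushReg_contents_clause, TM2.stepAux, Control.isDigit, hv', cond_true, pushVar_contents,
    Control.afterLetter, if_true, Option.getD_some, zero_add] using h1

theorem reaches_read_digits (w : List Bool) (hv' : v.inVar = true) (hv : v.reg = none) :
    Reaches program w.length
      ⟨some Block.read.entry, v, contents (w.map .bit ++ inp) out verts clause var⟩
      ⟨some Block.read.entry, v,
        contents inp out verts ((w.map fun b => .letter (.bit b)).reverse ++ clause)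
          (Function.update var v.lit
            ((w.map fun b => .letter (.bit b)).reverse ++ var v.lit))⟩ := by
  induction w generalizing clause var with
  | nil => simpa using Reaches.refl _
  | cons b w ih =>
    have h := (reaches_read_digit v (w.map .bit ++ inp) out verts clause var b hv').trans
      (by
        have e : { v with reg := none } = v := by rw [← hv]
        rw [e]
        exact ih _ _)
    rw [List.length_cons, add_comm]
    simpa using h

/-- Signs and digits are both bits; the flag `inVar` tells them apart. It is off for the first bit,
which is the sign, and on from there to the comma. -/
theorem reaches_read_literal (l : Literal) (hv' : v.inVar = false) (hv : v.reg = none) :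
    Reaches program (encodeLiteral l).length
      ⟨some Block.read.entry, v, contents (encodeLiteral l ++ inp) out verts clause var⟩
      ⟨some Block.read.entry,
        { v with sign := Function.update v.sign v.lit l.pos, lit := v.lit + 1 },
        contents inp out verts (((encodeLiteral l).map .letter).reverse ++ clause)
          (Function.update var v.lit
            (((encodeNat l.var).map .letter).reverse ++ var v.lit))⟩ := by
  obtain ⟨w, hw⟩ : ∃ w : List Bool, encodeNat l.var = w.map .bit :=
    ⟨Computability.encodeNat l.var, rfl⟩
  have h1 := reaches_read v (encodeNat l.var ++ .comma :: inp) out verts clause var (.bit l.pos)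
    (by simpa [Control.isDigit])
  simp only [reduceCtorEq, if_false, Control.afterLetter, hv'] at h1
  have h2 := h1.trans (by
    rw [hw]
    exact reaches_read_digits _ _ _ _ _ _ w rfl rfl)
  have h3 := h2.trans (reaches_read _ _ _ _ _ _ .comma rfl)
  simp only [reduceCtorEq, if_false, Control.afterLetter] at h3
  have e : (encodeLiteral l).length = 1 + w.length + 1 := by
    simp [encodeLiteral, hw, add_comm]
  rw [e]
  simpa [encodeLiteral, hw, hv, hv', Function.comp_def] using h3

theorem reaches_read_clause (s : Fin 3 → Bool) (c : Clause) :
    Reaches program (encodeClause c).length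
      ⟨some Block.read.entry, .loaded s true,
        contents (encodeClause c ++ inp) out verts [] fun _ => []⟩
      ⟨some Block.vars.entry, (loadedState c true inp out verts).1,
        (loadedState c true inp out verts).2⟩ := by
  have h1 := reaches_read (.loaded s true)
    (encodeLiteral (c.lit 0) ++ (encodeLiteral (c.lit 1) ++ (encodeLiteral (c.lit 2) ++
      (.ket :: inp)))) out verts [] (fun _ => []) .bra rfl
  simp only [reduceCtorEq, if_false, Control.afterLetter] at h1
  have h2 := h1.trans (reaches_read_literal _ _ _ _ _ _ (c.lit 0) rfl rfl)
  have h3 := h2.trans (reaches_read_literal _ _ _ _ _ _ (c.lit 1) rfl rfl)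
  have h4 := h3.trans (reaches_read_literal _ _ _ _ _ _ (c.lit 2) rfl rfl)
  have h5 := h4.trans (reaches_read _ _ _ _ _ _ .ket rfl)
  simp only [if_true, Control.afterLetter] at h5
  have e : (encodeClause c).length = 1 + (encodeLiteral (c.lit 0)).length +
      (encodeLiteral (c.lit 1)).length + (encodeLiteral (c.lit 2)).length + 1 := by
    simp [encodeClause]; omega
  rw [e]
  convert! h5 using 2
  · simp [encodeClause]
  · simp only [loadedState, Control.loaded, Control.mk.injEq, true_and, and_true]
    -- The literal counter lives in `Fin 3` and is back at 0 after three increments. All three old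
    -- signs have been overwritten.
    refine ⟨rfl, ?_⟩
    funext i
    fin_cases i <;> simp
  · simp only [loadedState]
    congr 1
    · simp [clauseWord, encodeClause]
    · funext i
      fin_cases i <;> simp [Control.loaded, varWord]

end Read

/-! ## The output of the machine -/

/-- The variables of the three literals are distinct. -/
def Clause.isProper (c : Clause) : Bool :=
  true && decide ((c.lit 0).var ≠ (c.lit 1).var) && decide ((c.lit 0).var ≠ (c.lit 2).var) &&
    decide ((c.lit 1).var ≠ (c.lit 2).var)

/-- The templates of the vertices for a clause. -/
def Clause.vertexTemplates (c : Clause) : List Template :=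
  (if c.isProper then clauseVertices else []) ++ varVertices

/-- The templates of the edges for a clause. -/
def Clause.edgeTemplates (c : Clause) : List (Template × Template) :=
  (if c.isProper then clauseEdges else []) ++ varEdges

/-- The edge for two templates. -/
def templateEdge (c : Clause) (e : Template × Template) : Vertex × Vertex :=
  (e.1.vertex c, e.2.vertex c)

/-- The lists of vertices and edges written by the machine. -/
def graphData (I : Instance) : GraphData Vertex where
  verts := (I.reverse.flatMap fun c => c.vertexTemplates.map (·.vertex c)) ++
    [.hub .u, .hub .v, .hub .hu, .hub .hu', .hub .hv, .hub .hv']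
  edges := (I.reverse.flatMap fun c => c.edgeTemplates.map (templateEdge c)) ++
    [(.hub .hu, .hub .hu'), (.hub .hu', .hub .u), (.hub .u, .hub .v), (.hub .v, .hub .hv'),
      (.hub .hv', .hub .hv)]

/-- The letters put on the stack `verts` for the clauses of `I`. -/
def instanceVerts (I : Instance) : List Letter :=
  I.reverse.flatMap fun c => vertsWord c c.vertexTemplates

/-- The letters put on the stack `out` for the clauses of `I`. -/
def instanceEdges (I : Instance) : List Letter :=
  I.reverse.flatMap fun c => vertsWord c (ends c.edgeTemplates)

theorem encode_graphData (I : Instance) :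
    (graphData I).encode encodeVertex = instanceVerts I ++ (hubWord hubVertices ++ (.endVerts ::
      (instanceEdges I ++ hubWord (ends hubEdges)))) := by
  simp [GraphData.encode, graphData, instanceVerts, instanceEdges, vertsWord, templateEdge,
    List.flatMap_assoc, List.flatMap_map, hubWord, hubVertices, hubEdges, ends]

/-- The number of names written for a clause. -/
def nameCount : ℕ :=
  varVertices.length + (ends varEdges).length + (clauseVertices.length + (ends clauseEdges).length)

theorem length_encodeClause_pos (c : Clause) : 1 ≤ (encodeClause c).length := by
  simp [encodeClause]

theorem length_encodeNat_le (n : ℕ) (hn : n < 8) : (encodeNat n).length ≤ 3 := by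
  interval_cases n <;> decide

/-- A name has a symbol for its kind, at most three digits of an index, at most one clause or
variable of that clause, and a delimiter. The additive constant 5 is absorbed because a clause has
positive length. -/
theorem length_encodeName_le (c : Clause) (t : Template) :
    (encodeName encodeVertex (t.vertex c)).length ≤ 6 * (encodeClause c).length := by
  have h := length_encodeClause_pos c
  have h2 := varWord_length_le c
  have hub : ∀ h : Hub, (encodeNat h.index).length ≤ 3 := by
    rintro ⟨⟩ <;> exact length_encodeNat_le _ (by decide)
  cases t with
  | hub k =>
    have := hub k
    simp [encodeName, encodeVertex, Template.vertex]; omega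
  | side i =>
    have := hub (if (c.lit i).pos then .u else .v)
    simp [encodeName, encodeVertex, Template.vertex]; omega
  | var i =>
    have := h2 i
    simp [varWord] at this
    simp [encodeName, encodeVertex, Template.vertex]; omega
  | copy i =>
    have := length_encodeNat_le i (by omega)
    simp [encodeName, encodeVertex, Template.vertex]; omega
  | q j =>
    have := length_encodeNat_le j (by omega)
    simp [encodeName, encodeVertex, Template.vertex]; omega

theorem length_vertsWord_le (c : Clause) (l : List Template) :
    (vertsWord c l).length ≤ l.length * (6 * (encodeClause c).length) := by
  induction l with
  | nil => simp [vertsWord]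
  | cons t l ih =>
    simp only [vertsWord, List.flatMap_cons, List.length_append, List.length_cons, add_mul,
      one_mul] at ih ⊢
    have := length_encodeName_le c t
    omega

/-- This bounds the cost of the final transfer of the vertex names to the output. -/
theorem length_instanceVerts_le (I : Instance) :
    (instanceVerts I).length ≤ nameCount * (6 * (encodeInstance I).length) := by
  induction I with
  | nil => simp [instanceVerts]
  | cons c I ih =>
    have h1 := length_vertsWord_le c c.vertexTemplates
    have h2 : c.vertexTemplates.length ≤ nameCount := by
      simp only [Clause.vertexTemplates, nameCount, List.length_append]
      split
      · omega
      · simp only [List.length_nil]; omega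
    have h3 := h1.trans (Nat.mul_le_mul_right _ h2)
    simp only [instanceVerts, List.reverse_cons, List.flatMap_append, List.flatMap_cons,
      List.flatMap_nil, List.append_nil, List.length_append, encodeInstance, mul_add] at ih ⊢
    omega

/-! ## The run of the machine -/

section Run

variable (c : Clause) (inp : List Γ') (out verts : List Letter)

/-- The flag `proper` is on at the start, and the three comparisons turn it into exactly the
conjunction that defines `Clause.isProper`. -/
theorem reaches_vars :
    Reaches program ((varVertices.length + (ends varEdges).length) *
        (2 * (encodeClause c).length + 4) + 3 * (5 * (encodeClause c).length + 5) + 1)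
      ⟨some Block.vars.entry, (loadedState c true inp out verts).1,
        (loadedState c true inp out verts).2⟩
      ⟨some (if c.isProper then Block.clause.entry else Block.clear.entry),
        (loadedState c c.isProper inp (vertsWord c (ends varEdges) ++ out)
          (vertsWord c varVertices ++ verts)).1,
        (loadedState c c.isProper inp (vertsWord c (ends varEdges) ++ out)
          (vertsWord c varVertices ++ verts)).2⟩ := by
  have h := reaches_block .vars (Block.code_valid _) (loadedState c true inp out verts)
  simp only [Block.code, codeTime_append, evalCode_append, evalCode_emitCode] at h
  rw [evalCode_compareCode 0 1 (by decide), evalCode_compareCode 0 2 (by decide),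
    evalCode_compareCode 1 2 (by decide)] at h
  refine h.mono ?_
  have h1 := codeTime_emitCode_le varVertices varEdges c true inp out verts
  refine Nat.succ_le_succ (le_trans (add_le_add h1 (add_le_add
    (codeTime_compareCode_le 0 1 (by decide) _ _ _ _ _) (add_le_add
      (codeTime_compareCode_le 0 2 (by decide) _ _ _ _ _)
      (codeTime_compareCode_le 1 2 (by decide) _ _ _ _ _)))) ?_)
  omega

theorem reaches_clause (p : Bool) :
    Reaches program ((clauseVertices.length + (ends clauseEdges).length) *
        (2 * (encodeClause c).length + 4) + 1)
      ⟨some Block.clause.entry, (loadedState c p inp out verts).1,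
        (loadedState c p inp out verts).2⟩
      ⟨some Block.clear.entry,
        (loadedState c p inp (vertsWord c (ends clauseEdges) ++ out)
          (vertsWord c clauseVertices ++ verts)).1,
        (loadedState c p inp (vertsWord c (ends clauseEdges) ++ out)
          (vertsWord c clauseVertices ++ verts)).2⟩ := by
  have h := reaches_block .clause (Block.code_valid _) (loadedState c p inp out verts)
  simp only [Block.code, evalCode_emitCode] at h
  exact h.mono (Nat.succ_le_succ (codeTime_emitCode_le ..))

theorem reaches_clear (p : Bool) :
    Reaches program (4 * (encodeClause c).length + 4 + 1)
      ⟨some Block.clear.entry, (loadedState c p inp out verts).1,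
        (loadedState c p inp out verts).2⟩
      ⟨some Block.read.entry, .loaded (fun i => (c.lit i).pos) true,
        contents inp out verts [] fun _ => []⟩ := by
  have h := reaches_block .clear (Block.code_valid _) (loadedState c p inp out verts)
  simp only [Block.code, evalCode_clearCode] at h
  exact h.mono (Nat.succ_le_succ (codeTime_clearCode_le ..))

/-- Writing `L` for the length of the clause, everything except the names takes at most `20 L + 22 ≤
42 L` steps, and each name at most `2 L + 4 ≤ 6 L`. -/
theorem reaches_whole_clause (s : Fin 3 → Bool) :
    Reaches program ((42 + 6 * nameCount) * (encodeClause c).length)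
      ⟨some Block.read.entry, .loaded s true,
        contents (encodeClause c ++ inp) out verts [] fun _ => []⟩
      ⟨some Block.read.entry, .loaded (fun i => (c.lit i).pos) true,
        contents inp (vertsWord c (ends c.edgeTemplates) ++ out)
          (vertsWord c c.vertexTemplates ++ verts) [] fun _ => []⟩ := by
  have h1 := (reaches_read_clause inp out verts s c).trans (reaches_vars c inp out verts)
  have hL := length_encodeClause_pos c
  have hN : nameCount * (2 * (encodeClause c).length + 4) ≤
      nameCount * (6 * (encodeClause c).length) := Nat.mul_le_mul_left _ (by omega)
  rw [add_mul, mul_assoc, ← mul_assoc 6, mul_comm 6, mul_assoc]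
  rw [nameCount, add_mul, add_mul _ _ (6 * _)] at hN
  rw [nameCount, add_mul]
  cases hp : c.isProper with
  | false =>
    simp only [hp, Bool.false_eq_true, if_false] at h1
    simp only [Clause.edgeTemplates, Clause.vertexTemplates, hp, Bool.false_eq_true, if_false,
      List.nil_append]
    exact (h1.trans (reaches_clear c _ _ _ _)).mono (by omega)
  | true =>
    simp only [hp, if_true] at h1
    have h2 := (h1.trans (reaches_clause c _ _ _ _)).trans (reaches_clear c _ _ _ _)
    have e : ∀ l l' : List Template, vertsWord c (l ++ l') = vertsWord c l ++ vertsWord c l' :=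
      fun l l' => List.flatMap_append
    have e' : ∀ l l' : List (Template × Template), ends (l ++ l') = ends l ++ ends l' :=
      fun l l' => List.flatMap_append
    simp only [Clause.edgeTemplates, Clause.vertexTemplates, hp, if_true, e, e', List.append_assoc]
    exact h2.mono (by omega)

theorem reaches_instance (I : Instance) (s : Fin 3 → Bool) : ∃ s' : Fin 3 → Bool,
    Reaches program ((42 + 6 * nameCount) * (encodeInstance I).length)
      ⟨some Block.read.entry, .loaded s true,
        contents (encodeInstance I) out verts [] fun _ => []⟩
      ⟨some Block.read.entry, .loaded s' true,
        contents [] (instanceEdges I ++ out) (instanceVerts I ++ verts) [] fun _ => []⟩ := by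
  induction I generalizing s out verts with
  | nil => exact ⟨s, by simpa [encodeInstance, instanceEdges, instanceVerts] using Reaches.refl _⟩
  | cons c I ih =>
    have h1 := reaches_whole_clause c (encodeInstance I) out verts s
    obtain ⟨s', h2⟩ := ih _ _ _
    refine ⟨s', ?_⟩
    have h3 := h1.trans h2
    rw [← mul_add] at h3
    simpa [encodeInstance, instanceEdges, instanceVerts] using h3

theorem reaches_finish (s : Fin 3 → Bool) :
    Reaches program (2 * verts.length + 5)
      ⟨some Block.read.entry, .loaded s true, contents [] out verts [] fun _ => []⟩
      ⟨none, .initial, contents [] (verts ++ .endVerts :: out) [] [] fun _ => []⟩ := by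
  have h1 := reaches_block .read (Block.code_valid _)
    (.loaded s true, contents [] out verts [] fun _ => [])
  have e : contents [] out verts [] (fun _ => []) none = [] := rfl
  simp only [Block.code, codeTime, evalCode, List.foldl_nil, Block.exit, readStmt, TM2.stepAux, e,
    List.head?_nil, List.tail_nil, Option.map_none, Option.isNone_none, cond_true,
    update_contents_none] at h1
  -- The vertex names pass through `aux` so that two reversals cancel.
  have h2 := reaches_block .finish (Block.code_valid _)
    (.loaded s true, contents [] out verts [] fun _ => [])
  have h3 := h1.trans h2
  have e2 : codeTime Block.finish.code (.loaded s true, contents [] out verts [] fun _ => []) =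
      2 * verts.length + 3 := by
    simp [Block.code, codeTime, Instr.time, Instr.eval, contents]
    omega
  rw [e2] at h3
  refine Eq.subst ?_ (h3.mono (by omega))
  simp only [Block.exit, TM2.stepAux]
  congr 1
  simp only [Block.code, evalCode, List.foldl, Instr.eval]
  funext k
  rcases k with _ | _ | _ | _ | k | _ | _ | _ <;> simp [contents]

theorem reaches_start :
    Reaches program 3
      ⟨some Block.start.entry, .initial, contents inp [] [] [] fun _ => []⟩
      ⟨some Block.read.entry, .loaded (fun _ => false) true,
        contents inp (hubWord (ends hubEdges)) (hubWord hubVertices) [] fun _ => []⟩ := by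
  have h := reaches_block .start (Block.code_valid _) (.initial, contents inp [] [] [] fun _ => [])
  have e1 : contents inp [] [] [] (fun _ => []) (some .verts) = [] := rfl
  have e2 : ∀ w, contents inp [] w [] (fun _ => []) (some .out) = [] := fun _ => rfl
  simp only [Block.code, codeTime, evalCode, List.foldl, Instr.eval, Instr.time, if_true,
    update_contents_verts, update_contents_out, e1, e2, List.append_nil] at h
  exact h

/-- The coefficient 18 is 6 for writing the names plus twice 6 for moving the vertex names through
`aux`. -/
theorem reaches_output (I : Instance) :
    Reaches program ((42 + 18 * nameCount) * (encodeInstance I).length +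
        (2 * (hubWord hubVertices).length + 8))
      ⟨some Block.start.entry, .initial, contents (encodeInstance I) [] [] [] fun _ => []⟩
      ⟨none, .initial, contents [] ((graphData I).encode encodeVertex) [] [] fun _ => []⟩ := by
  obtain ⟨s, h⟩ := reaches_instance (hubWord (ends hubEdges)) (hubWord hubVertices) I fun _ => false
  have h1 := ((reaches_start (encodeInstance I)).trans h).trans (reaches_finish _ _ s)
  rw [encode_graphData]
  rw [List.append_assoc] at h1
  refine h1.mono ?_
  have := length_instanceVerts_le I
  rw [List.length_append]
  have e : nameCount * (6 * (encodeInstance I).length) =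
      6 * nameCount * (encodeInstance I).length := by
    ring
  rw [e] at this
  have e2 : (42 + 18 * nameCount) * (encodeInstance I).length =
      (42 + 6 * nameCount) * (encodeInstance I).length +
        2 * (6 * nameCount * (encodeInstance I).length) := by ring
  omega

end Run

/-- The machine. -/
noncomputable def machine : FinTM2 where
  K := Option Stack
  k₀ := none
  k₁ := some .out
  Γ := StackAlphabet
  Λ := Label
  main := Block.start.entry
  σ := Control
  initialState := .initial
  Γk₀Fin := inferInstanceAs (Fintype Γ')
  m := program

theorem initList_machine (w : List Γ') :
    initList machine w = ⟨some Block.start.entry, .initial, contents w [] [] [] fun _ => []⟩ := by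
  unfold initList
  congr 1
  funext k
  rcases k with _ | _ | _ | _ | k | _ | _ | _ <;> rfl

theorem haltList_machine (w : List Letter) :
    haltList machine w = ⟨none, .initial, contents [] w [] [] fun _ => []⟩ := by
  unfold haltList
  congr 1
  funext k
  rcases k with _ | _ | _ | _ | k | _ | _ | _ <;> rfl

theorem nonempty_computable :
    Nonempty
      (TM2ComputableInPolyTime encodeInstance (GraphData.encode encodeVertex) graphData) := by
  refine ⟨{
    tm := machine
    inputAlphabet := Equiv.refl Γ'
    outputAlphabet := Equiv.refl Letter
    time := .C (42 + 18 * nameCount) * .X + .C (2 * (hubWord hubVertices).length + 8)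
    outputsFun := fun I => ?_ }⟩
  -- The alphabets are identified by identity maps, which have to be removed from the words.
  have h1 := (congrArg (initList machine) (List.map_id (encodeInstance I))).trans
    (initList_machine _)
  have h2 := (congrArg (haltList machine)
    (List.map_id ((graphData I).encode encodeVertex))).trans (haltList_machine _)
  have h := reaches_output I
  exact ⟨⟨h.choose, (congrArg (fun a => (flip bind machine.step)^[h.choose] (some a)) h1).trans
    (h.choose_spec.2.trans (congrArg some h2).symm)⟩, by simpa using h.choose_spec.1⟩

/-! ## The output represents the graph -/

/-- Two distinct literals with the same variable have opposite signs. This is why comparing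
variables suffices to recognize tautologies. -/
theorem Clause.not_isTautology_iff (c : Clause) :
    ¬ c.IsTautology ↔ Function.Injective fun i => (c.lit i).var := by
  constructor
  · intro h i j hij
    by_contra hne
    have hp : (c.lit i).pos ≠ (c.lit j).pos := by
      intro hp
      apply hne
      apply c.distinct
      cases hi : c.lit i
      cases hj : c.lit j
      simp_all
    cases hi : (c.lit i).pos with
    | true => exact h ⟨i, j, hij, hi, Bool.eq_false_iff.2 fun hj => hp (hi.trans hj.symm)⟩
    | false =>
      exact h ⟨j, i, hij.symm, Bool.eq_true_of_not_eq_false fun hj => hp (hi.trans hj.symm), hi⟩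
  · rintro h ⟨i, j, hij, hi, hj⟩
    obtain rfl := h hij
    simp [hi] at hj

theorem Clause.isProper_iff (c : Clause) : c.isProper = true ↔ ¬ c.IsTautology := by
  rw [c.not_isTautology_iff]
  simp only [Clause.isProper, Bool.true_and, Bool.and_eq_true, decide_eq_true_eq]
  constructor
  · rintro ⟨⟨h1, h2⟩, h3⟩ i j hij
    fin_cases i <;> fin_cases j <;> simp_all [eq_comm]
  · intro h
    exact ⟨⟨h.ne (by decide), h.ne (by decide)⟩, h.ne (by decide)⟩

theorem mem_vertexTemplates {c : Clause} {a : Vertex} :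
    (∃ t ∈ c.vertexTemplates, t.vertex c = a) ↔
      (¬ c.IsTautology ∧ ((∃ i, .copy c i = a) ∨ ∃ j, .q c j = a)) ∨
        ∃ i, .var (c.lit i).var = a := by
  rw [← c.isProper_iff]
  cases h : c.isProper <;>
    simp [Clause.vertexTemplates, h, clauseVertices, varVertices, or_and_right, exists_or,
      Template.vertex, or_assoc]

theorem mem_edgeTemplates {c : Clause} {e : Vertex × Vertex} :
    (∃ t ∈ c.edgeTemplates, templateEdge c t = e) ↔
      (¬ c.IsTautology ∧ ((∃ i j, M i j = 1 ∧ (g c i, .q c j) = e) ∨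
        (∃ i, (.copy c i, .hub (if (c.lit i).pos then .u else .v)) = e) ∨
        ∃ j : Fin 7, (.q c j.castSucc, .q c j.succ) = e)) ∨
      ∃ i, (.var (c.lit i).var, .hub .u) = e ∨ (.var (c.lit i).var, .hub .v) = e := by
  have hg : ∀ i, (gTemplate i).vertex c = g c i := by
    intro i
    fin_cases i <;> rfl
  have hv : ∀ i, (Template.var i).vertex c = .var (c.lit i).var := fun _ => rfl
  have hc : ∀ i, (Template.copy i).vertex c = .copy c i := fun _ => rfl
  have hq : ∀ j, (Template.q j).vertex c = .q c j := fun _ => rfl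
  have hh : ∀ h, (Template.hub h).vertex c = .hub h := fun _ => rfl
  have hs : ∀ i, (Template.side i).vertex c = .hub (if (c.lit i).pos then .u else .v) :=
    fun _ => rfl
  rw [← c.isProper_iff]
  cases h : c.isProper <;>
    simp [Clause.edgeTemplates, h, clauseEdges, varEdges, or_and_right, exists_or,
      templateEdge, hg, hv, hc, hq, hh, hs, or_assoc]

theorem mem_graphData_verts {I : Instance} {a : Vertex} :
    a ∈ (graphData I).verts ↔ IsVertex I a := by
  have key : a ∈ (graphData I).verts ↔ (∃ c ∈ I, ∃ t ∈ c.vertexTemplates, t.vertex c = a) ∨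
      ∃ h, a = .hub h := by
    simp only [graphData, List.mem_append, List.mem_flatMap, List.mem_reverse, List.mem_map]
    refine or_congr Iff.rfl ⟨fun h => ?_, ?_⟩
    · simp only [List.mem_cons, List.not_mem_nil, or_false] at h
      rcases h with h | h | h | h | h | h <;> exact ⟨_, h⟩
    · rintro ⟨⟨⟩, rfl⟩ <;> simp
  rw [key]
  clear key
  simp only [mem_vertexTemplates]
  constructor
  · rintro (⟨c, hc, ⟨ht, ⟨i, rfl⟩ | ⟨j, rfl⟩⟩ | ⟨i, rfl⟩⟩ | ⟨h, rfl⟩)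
    exacts [.copy c ⟨hc, ht⟩ i, .q c ⟨hc, ht⟩ j, .var _ ⟨c, hc, i, rfl⟩, .hub h]
  · rintro (h | ⟨x, c, hc, i, rfl⟩ | ⟨c, hc, i⟩ | ⟨c, hc, j⟩)
    · exact .inr ⟨h, rfl⟩
    · exact .inl ⟨c, hc, .inr ⟨i, rfl⟩⟩
    · exact .inl ⟨c, hc.1, .inl ⟨hc.2, .inl ⟨i, rfl⟩⟩⟩
    · exact .inl ⟨c, hc.1, .inl ⟨hc.2, .inr ⟨j, rfl⟩⟩⟩

theorem mem_graphData_edges {I : Instance} {a b : Vertex} :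
    (a, b) ∈ (graphData I).edges ↔ IsEdge I a b := by
  have key : (a, b) ∈ (graphData I).edges ↔
      (∃ c ∈ I, ∃ t ∈ c.edgeTemplates, templateEdge c t = (a, b)) ∨
        (a, b) ∈ [(Vertex.hub .hu, Vertex.hub .hu'), (.hub .hu', .hub .u), (.hub .u, .hub .v),
          (.hub .v, .hub .hv'), (.hub .hv', .hub .hv)] := by
    simp only [graphData, List.mem_append, List.mem_flatMap, List.mem_reverse, List.mem_map]
  rw [key]
  clear key
  simp only [mem_edgeTemplates, List.mem_cons, List.not_mem_nil, or_false, Prod.mk.injEq]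
  constructor
  · rintro (⟨c, hc, ⟨ht, ⟨i, j, hM, rfl, rfl⟩ | ⟨i, rfl, rfl⟩ | ⟨j, rfl, rfl⟩⟩ |
      ⟨i, ⟨rfl, rfl⟩ | ⟨rfl, rfl⟩⟩⟩ |
      ⟨rfl, rfl⟩ | ⟨rfl, rfl⟩ | ⟨rfl, rfl⟩ | ⟨rfl, rfl⟩ | ⟨rfl, rfl⟩)
    · exact .matrix c ⟨hc, ht⟩ i j hM
    · cases h : (c.lit i).pos with
      | true => simpa using .positive c ⟨hc, ht⟩ i h
      | false => simpa using .negative c ⟨hc, ht⟩ i h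
    · exact .path c ⟨hc, ht⟩ j
    · exact .var_u _ ⟨c, hc, i, rfl⟩
    · exact .var_v _ ⟨c, hc, i, rfl⟩
    exacts [.hu_hu', .hu'_u, .u_v, .v_hv', .hv'_hv]
  · intro h
    cases h with
    | matrix c hc i j h => exact .inl ⟨c, hc.1, .inl ⟨hc.2, .inl ⟨i, j, h, rfl, rfl⟩⟩⟩
    | positive c hc i h =>
      exact .inl ⟨c, hc.1, .inl ⟨hc.2, .inr (.inl ⟨i, rfl, by simp [h]⟩)⟩⟩
    | negative c hc i h =>
      exact .inl ⟨c, hc.1, .inl ⟨hc.2, .inr (.inl ⟨i, rfl, by simp [h]⟩)⟩⟩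
    | path c hc j => exact .inl ⟨c, hc.1, .inl ⟨hc.2, .inr (.inr ⟨j, rfl, rfl⟩)⟩⟩
    | var_u x hx =>
      obtain ⟨c, hc, i, rfl⟩ := hx
      exact .inl ⟨c, hc, .inr ⟨i, .inl ⟨rfl, rfl⟩⟩⟩
    | var_v x hx =>
      obtain ⟨c, hc, i, rfl⟩ := hx
      exact .inl ⟨c, hc, .inr ⟨i, .inr ⟨rfl, rfl⟩⟩⟩
    | _ => simp

theorem f_adj {I : Instance} {a b : vertexSet I} :
    (f I).Adj a b ↔ IsEdge I a b ∨ IsEdge I b a := by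
  rw [f, SimpleGraph.fromRel_adj]
  refine ⟨fun h => h.2, fun h => ⟨?_, h⟩⟩
  rintro rfl
  rcases h with h | h <;> exact h.isVertex.2.2 rfl

theorem graphData_represents (I : Instance) : (graphData I).Represents (f I) := by
  refine ⟨fun a => mem_graphData_verts, ?_, fun a b => ?_⟩
  · rintro ⟨a, b⟩ he
    have := (mem_graphData_edges.1 he).isVertex
    exact ⟨this.1, this.2.1⟩
  · rw [f_adj, mem_graphData_edges, mem_graphData_edges]

/-! ## Trees -/

open SimpleGraph

section Graph

variable {V : Type*} {G T : SimpleGraph V}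

/-- A relation that gives every vertex but one a unique vertex of smaller rank defines a tree. -/
theorem isTree_fromRel {P : V → V → Prop} (root : V) (rank : V → ℕ)
    (hP : ∀ a b b', P a b → P a b' → b = b') (hr : ∀ a b, P a b → rank b < rank a)
    (he : ∀ a, a = root ∨ ∃ b, P a b) : (SimpleGraph.fromRel P).IsTree := by
  have adj : ∀ a b, P a b → (SimpleGraph.fromRel P).Adj a b := fun a b h => by
    rw [fromRel_adj]
    exact ⟨fun e => (hr a b h).ne (by rw [e]), .inl h⟩
  refine ⟨?_, ?_⟩
  · have key : ∀ n a, rank a = n → (SimpleGraph.fromRel P).Reachable a root := by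
      intro n
      induction n using Nat.strong_induction_on with
      | _ n ih =>
        rintro a rfl
        rcases he a with rfl | ⟨b, hb⟩
        · exact .rfl
        · exact (adj a b hb).reachable.trans (ih _ (hr a b hb) b rfl)
    have : Nonempty V := ⟨root⟩
    exact ⟨fun a b => (key _ a rfl).trans (key _ b rfl).symm⟩
  · classical
    intro a p hp
    -- On a cycle, both neighbours of a vertex of maximal rank would have to be its unique parent,
    -- but they are distinct.
    obtain ⟨m, hm, hmax⟩ := p.support.toFinset.exists_max_image rank ⟨a, by simp⟩
    simp only [List.mem_toFinset] at hm hmax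
    have up : ∀ b ∈ p.support, (SimpleGraph.fromRel P).Adj m b → P m b := by
      intro b hb hmb
      rcases ((fromRel_adj _ _ _).1 hmb).2 with h | h
      · exact h
      · exact absurd (hr b m h) (hmax b hb).not_gt
    have hc := hp.rotate hm
    have mem : ∀ b ∈ (p.rotate m hm).support, b ∈ p.support := fun b hb => by
      simpa using hb
    refine hc.snd_ne_penultimate (hP m _ _ (up _ (mem _ ?_) ?_) (up _ (mem _ ?_) ?_))
    · exact Walk.getVert_mem_support _ _
    · exact Walk.adj_snd hc.not_nil
    · exact Walk.getVert_mem_support _ _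
    · exact (Walk.adj_penultimate hc.not_nil).symm

/-- The stretch condition on edges adds up along a shortest walk of `G`. -/
theorem dist_le_mul_dist (hT : T.Connected) (hG : G.Connected) (t : ℕ)
    (h : ∀ x y, G.Adj x y → T.dist x y ≤ t) (x y : V) : T.dist x y ≤ t * G.dist x y := by
  obtain ⟨p, hp⟩ := hG.exists_walk_length_eq_dist x y
  rw [← hp]
  clear hp
  induction p with
  | nil => simp
  | @cons a b c hab p ih =>
    have := hT.dist_triangle (u := a) (v := b) (w := c)
    have := h a b hab
    rw [Walk.length_cons, mul_add, mul_one]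
    omega

theorem IsAcyclic.length_eq_dist (hT : T.IsAcyclic) {x y : V} {p : T.Walk x y} (hp : p.IsPath) :
    p.length = T.dist x y := by
  obtain ⟨q, hq, hl⟩ := p.reachable.exists_path_of_dist
  rw [← hl]
  have := hT.subsingleton_path x y
  exact congrArg (fun p : T.Path x y => p.1.length) (Subsingleton.elim ⟨p, hp⟩ ⟨q, hq⟩)

theorem exists_adj_adj_of_dist_eq_two {x y : V} (h : T.dist x y = 2) :
    ∃ z, T.Adj x z ∧ T.Adj z y := by
  -- Unreachable pairs have the default distance 0, so distance two implies reachability.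
  have hr : T.Reachable x y := by
    by_contra hr
    rw [dist_eq_zero_of_not_reachable hr] at h
    omega
  obtain ⟨p, hp⟩ := hr.exists_walk_length_eq_dist
  rw [h] at hp
  obtain _ | ⟨h1, p⟩ := p
  · simp at hp
  obtain _ | ⟨h2, p⟩ := p
  · simp at hp
  obtain _ | ⟨h3, p⟩ := p
  · exact ⟨_, h1, h2⟩
  · simp at hp

/-- The first edge of a shortest path. -/
theorem exists_adj_dist_eq (hT : T.Connected) {x y : V} (h : x ≠ y) :
    ∃ z, T.Adj x z ∧ T.dist x y = T.dist z y + 1 := by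
  obtain ⟨p, hp⟩ := hT.exists_walk_length_eq_dist x y
  obtain _ | @⟨_, z, _, h1, p⟩ := p
  · exact absurd rfl h
  refine ⟨_, h1, ?_⟩
  rw [Walk.length_cons] at hp
  have h2 := dist_le p
  have h4 := dist_eq_one_iff_adj.2 h1
  have := hT.dist_triangle (u := x) (v := z) (w := y)
  omega

/-- If `a` is a leaf whose neighbour `b` has only one more neighbour `c`, then the distances to `a`
are those to `c` plus two. -/
theorem dist_add_two_le (hT : T.Connected) {a b c y : V} (ha : ∀ z, T.Adj a z → z = b)
    (hb : ∀ z, T.Adj b z → z = a ∨ z = c) (hya : a ≠ y) (hyb : b ≠ y) :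
    T.dist c y + 2 ≤ T.dist a y := by
  obtain ⟨z, hz, h1⟩ := exists_adj_dist_eq hT hya
  obtain rfl := ha z hz
  obtain ⟨w, hw, h2⟩ := exists_adj_dist_eq hT hyb
  rcases hb w hw with rfl | rfl <;> omega

end Graph

/-! ## From assignments to trees -/

/-- The hub vertex for a truth value. -/
def sideHub (s : Bool) : Vertex := .hub (if s then .u else .v)

/-- The row of the gadget matrix for a variable. -/
def varRow : Fin 3 → Fin 6 := ![0, 2, 4]

/-- The row of the gadget matrix for a copy of a variable. -/
def copyRow : Fin 3 → Fin 6 := ![1, 3, 5]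

theorem g_varRow (c : Clause) (i : Fin 3) : g c (varRow i) = .var (c.lit i).var := by
  fin_cases i <;> rfl

theorem g_copyRow (c : Clause) (i : Fin 3) : g c (copyRow i) = .copy c i := by
  fin_cases i <;> rfl

theorem exists_row_eq (r : Fin 6) : ∃ i, r = varRow i ∨ r = copyRow i := by
  revert r
  decide

/-- The two rows belonging to one literal are complementary, so every `q`-vertex can hang below any
chosen literal. -/
theorem M_copyRow (i : Fin 3) (j : Fin 8) (h : M (varRow i) j ≠ 1) : M (copyRow i) j = 1 := by
  revert i j
  decide

section Tree

variable {I : Instance} (A : ℕ → Bool) (k : Clause → Fin 3)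

/-- The parents of the vertices in the tree for the assignment `A`, where `k c` is a true literal
of the clause `c`. -/
def parent : Vertex → Option Vertex
  | .hub .u => none
  | .hub .v => some (.hub .u)
  | .hub .hu' => some (.hub .u)
  | .hub .hu => some (.hub .hu')
  | .hub .hv' => some (.hub .v)
  | .hub .hv => some (.hub .hv')
  | .var x => some (sideHub (A x))
  | .copy c i => some (sideHub (c.lit i).pos)
  | .q c j => some (if M (varRow (k c)) j = 1 then .var (c.lit (k c)).var else .copy c (k c))

/-- The distance from the edge `uv`. -/
def depth : Vertex → ℕ
  | .hub .u | .hub .v => 0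
  | .hub .hu' | .hub .hv' | .var _ | .copy _ _ => 1
  | .hub .hu | .hub .hv | .q _ _ => 2

/-- The end of the edge `uv` which is closer. -/
def side : Vertex → Bool
  | .hub .u | .hub .hu' | .hub .hu => true
  | .hub .v | .hub .hv' | .hub .hv => false
  | .var x => A x
  | .copy c i => (c.lit i).pos
  | .q c _ => (c.lit (k c)).pos

/-- The distance from `u`. -/
def rank (a : Vertex) : ℕ := depth a + if side A k a then 0 else 1

theorem isVertex_sideHub (s : Bool) : IsVertex I (sideHub s) := .hub _

theorem depth_sideHub (s : Bool) : depth (sideHub s) = 0 := by cases s <;> rfl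

theorem side_sideHub (s : Bool) : side A k (sideHub s) = s := by cases s <;> rfl

theorem isEdge_var {x : ℕ} (hx : x ∈ I.vars) (s : Bool) : IsEdge I (.var x) (sideHub s) := by
  cases s
  exacts [.var_v x hx, .var_u x hx]

theorem isEdge_copy {c : Clause} (hc : c ∈ I.properClauses) (i : Fin 3) :
    IsEdge I (.copy c i) (sideHub (c.lit i).pos) := by
  cases h : (c.lit i).pos
  exacts [.negative c hc i h, .positive c hc i h]

/-- All properties of `parent` used later: it follows edges of the graph, and it lowers the depth by
one without changing the side, except for the step from `v` to the root `u`. That exception is why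
`rank` adds one on the side of `v`. -/
theorem exists_parent
    (hk : ∀ c ∈ I, A (c.lit (k c)).var = (c.lit (k c)).pos) {a : Vertex}
    (ha : IsVertex I a) : a = sideHub true ∨
    ∃ b, parent A k a = some b ∧ (IsEdge I a b ∨ IsEdge I b a) ∧
      ((a = sideHub false ∧ b = sideHub true) ∨
        side A k b = side A k a ∧ depth a = depth b + 1) := by
  cases ha with
  | hub h =>
    cases h with
    | u => exact .inl rfl
    | v => exact .inr ⟨_, rfl, .inr .u_v, .inl ⟨rfl, rfl⟩⟩
    | hu => exact .inr ⟨_, rfl, .inl .hu_hu', .inr ⟨rfl, rfl⟩⟩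
    | hu' => exact .inr ⟨_, rfl, .inl .hu'_u, .inr ⟨rfl, rfl⟩⟩
    | hv => exact .inr ⟨_, rfl, .inr .hv'_hv, .inr ⟨rfl, rfl⟩⟩
    | hv' => exact .inr ⟨_, rfl, .inr .v_hv', .inr ⟨rfl, rfl⟩⟩
  | var x hx =>
    exact .inr ⟨_, rfl, .inl (isEdge_var hx _), .inr ⟨side_sideHub .., by rw [depth_sideHub]; rfl⟩⟩
  | copy c hc i =>
    exact .inr ⟨_, rfl, .inl (isEdge_copy hc i),
      .inr ⟨side_sideHub .., by rw [depth_sideHub]; rfl⟩⟩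
  | q c hc j =>
    refine .inr ⟨_, rfl, ?_⟩
    split_ifs with h
    -- Here the truth of the chosen literal is needed: its variable hangs on the side given by the
    -- sign, like its copy.
    · refine ⟨.inr ?_, .inr ⟨hk c hc.1, rfl⟩⟩
      rw [← g_varRow]
      exact .matrix c hc _ j h
    · refine ⟨.inr ?_, .inr ⟨rfl, rfl⟩⟩
      rw [← g_copyRow]
      exact .matrix c hc _ j (M_copyRow _ _ h)

/-- The tree for an assignment. -/
def assignmentTree (I : Instance) : SimpleGraph (vertexSet I) :=
  SimpleGraph.fromRel fun a b => parent A k a = some b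

theorem assignmentTree_isTree
    (hk : ∀ c ∈ I, A (c.lit (k c)).var = (c.lit (k c)).pos) : (assignmentTree A k I).IsTree := by
  refine isTree_fromRel ⟨sideHub true, isVertex_sideHub _⟩ (fun a => rank A k a) ?_ ?_ ?_
  · intro a b b' h h'
    exact Subtype.ext (Option.some.inj (h.symm.trans h'))
  · intro a b h
    rcases exists_parent A k hk a.2 with h' | ⟨c, hc, -, h'⟩
    · rw [h'] at h
      cases h
    · obtain rfl := Option.some.inj (hc.symm.trans h)
      rcases h' with ⟨h1, h2⟩ | ⟨h1, h2⟩
      · simp [rank, h1, h2, depth_sideHub, side_sideHub]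
      · simp only [rank, h1, h2]
        omega
  · intro a
    rcases exists_parent A k hk a.2 with h' | ⟨c, hc, he, -⟩
    · exact .inl (Subtype.ext h')
    · have hv : IsVertex I c := by
        rcases he with h | h
        exacts [h.isVertex.2.1, h.isVertex.1]
      exact .inr ⟨⟨c, hv⟩, hc⟩

theorem assignmentTree_le
    (hk : ∀ c ∈ I, A (c.lit (k c)).var = (c.lit (k c)).pos) : assignmentTree A k I ≤ f I := by
  have key : ∀ a b : vertexSet I, parent A k a = some (b : Vertex) → (f I).Adj a b := by
    intro a b h
    rw [f_adj]
    rcases exists_parent A k hk a.2 with h' | ⟨c, hc, he, -⟩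
    · rw [h'] at h
      cases h
    · obtain rfl := Option.some.inj (hc.symm.trans h)
      exact he
  intro a b h
  rcases ((fromRel_adj _ _ _).1 h).2 with h | h
  exacts [key a b h, (key b a h).symm]

theorem assignmentTree_adj {a b : vertexSet I} (hne : a ≠ b)
    (h : parent A k a = some (b : Vertex)) :
    (assignmentTree A k I).Adj a b := (fromRel_adj _ _ _).2 ⟨hne, .inl h⟩

theorem dist_sideHub_le
    (hk : ∀ c ∈ I, A (c.lit (k c)).var = (c.lit (k c)).pos) (n : ℕ)
    (a : vertexSet I) (h : depth a = n) :
    (assignmentTree A k I).dist a ⟨sideHub (side A k a), isVertex_sideHub _⟩ ≤ n := by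
  have hT := (assignmentTree_isTree A k hk).connected
  induction n generalizing a with
  | zero =>
    have e : a = ⟨sideHub (side A k a), isVertex_sideHub _⟩ := by
      apply Subtype.ext
      obtain ⟨a, ha⟩ := a
      rcases a with (_ | _) | _ | _ | _ <;> first | rfl | cases h
    rw [← e]
    simp
  | succ n ih =>
    rcases exists_parent A k hk a.2 with h' | ⟨c, hc, he, h'⟩
    · rw [h', depth_sideHub] at h
      cases h
    · rcases h' with ⟨h1, h2⟩ | ⟨h1, h2⟩
      · rw [h1, depth_sideHub] at h
        cases h
      · have hv : IsVertex I c := by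
          rcases he with h | h
          exacts [h.isVertex.2.1, h.isVertex.1]
        have hne : a ≠ ⟨c, hv⟩ := by
          rintro rfl
          simp at h2
        have h3 := dist_eq_one_iff_adj.2 (assignmentTree_adj A k hne hc)
        have h4 := ih ⟨c, hv⟩ (by simp only; omega)
        simp only [h1] at h4
        have h5 := hT.dist_triangle (u := a) (v := ⟨c, hv⟩)
          (w := ⟨sideHub (side A k a), isVertex_sideHub _⟩)
        omega

/-- Climb from each vertex to its end of `uv`, and cross that edge if the ends differ. -/
theorem dist_assignmentTree_le
    (hk : ∀ c ∈ I, A (c.lit (k c)).var = (c.lit (k c)).pos) (a b : vertexSet I) :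
    (assignmentTree A k I).dist a b ≤
      depth a + depth b + if side A k a = side A k b then 0 else 1 := by
  have hT := (assignmentTree_isTree A k hk).connected
  have h1 := dist_sideHub_le A k hk _ a rfl
  have h2 := dist_sideHub_le A k hk _ b rfl
  rw [dist_comm] at h2
  have h3 : (assignmentTree A k I).dist ⟨sideHub (side A k a), isVertex_sideHub _⟩
      ⟨sideHub (side A k b), isVertex_sideHub _⟩ ≤ if side A k a = side A k b then 0 else 1 := by
    have huv : (assignmentTree A k I).Adj ⟨sideHub false, isVertex_sideHub _⟩
        ⟨sideHub true, isVertex_sideHub _⟩ :=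
      assignmentTree_adj A k (by simp [sideHub]) rfl
    cases side A k a <;> cases side A k b
    · simp
    · simpa using (dist_eq_one_iff_adj.2 huv).le
    · simpa using (dist_eq_one_iff_adj.2 huv.symm).le
    · simp
  have h4 := hT.dist_triangle (u := a) (v := ⟨sideHub (side A k a), isVertex_sideHub _⟩) (w := b)
  have h5 := hT.dist_triangle (u := ⟨sideHub (side A k a), isVertex_sideHub _⟩)
    (v := ⟨sideHub (side A k b), isVertex_sideHub _⟩) (w := b)
  omega

/-- Except for path edges, the depths of the ends add up to at most 3, which leaves room for
crossing `uv`. On path edges the sum is 4, but both ends belong to one clause and are on the same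
side. -/
theorem IsEdge.depth_add_depth_le {a b : Vertex} (h : IsEdge I a b) :
    depth a + depth b + (if side A k a = side A k b then 0 else 1) ≤ 4 := by
  cases h with
  | matrix c hc r j h =>
    have : depth (g c r) = 1 := by fin_cases r <;> rfl
    rw [this]
    simp only [depth]
    split_ifs <;> omega
  | path c hc j => simp [depth, side]
  | _ =>
    simp only [depth]
    split_ifs <;> omega

theorem depth_le (a : Vertex) : depth a ≤ 2 := by
  unfold depth
  split <;> omega

theorem assignmentTree_isTreeSpanner
    (hk : ∀ c ∈ I, A (c.lit (k c)).var = (c.lit (k c)).pos) :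
    IsTreeSpanner 4 (f I) (assignmentTree A k I) := by
  have hT := assignmentTree_isTree A k hk
  have hle := assignmentTree_le A k hk
  refine ⟨hle, hT, dist_le_mul_dist hT.connected (hT.connected.mono hle) 4 fun a b h => ?_⟩
  rw [f_adj] at h
  rcases h with h | h
  · exact (dist_assignmentTree_le A k hk a b).trans (h.depth_add_depth_le A k)
  · rw [dist_comm]
    exact (dist_assignmentTree_le A k hk b a).trans (h.depth_add_depth_le A k)

theorem assignmentTree_ediam_le
    (hk : ∀ c ∈ I, A (c.lit (k c)).var = (c.lit (k c)).pos) : (assignmentTree A k I).ediam ≤ 5 := by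
  refine ediam_le_of_edist_le fun a b => ?_
  rw [← ((assignmentTree_isTree A k hk).connected a b).coe_dist_eq_edist]
  have h1 := dist_assignmentTree_le A k hk a b
  have h2 := depth_le a
  have h3 := depth_le b
  have : (assignmentTree A k I).dist a b ≤ 5 := by
    split_ifs at h1 <;> omega
  exact_mod_cast this

end Tree

theorem exists_treeSpanner {I : Instance} (h : I.Satisfiable) :
    ∃ T : SimpleGraph (vertexSet I), IsTreeSpanner 4 (f I) T ∧ T.ediam ≤ 5 := by
  obtain ⟨A, hA⟩ := h
  choose! k hk using hA
  exact ⟨_, assignmentTree_isTreeSpanner A k hk, assignmentTree_ediam_le A k hk⟩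

/-! ## From trees to assignments -/

/-! ### Neighbourhoods in the graph -/

section Inversion

variable {I : Instance}

theorem g_ne_hub (c : Clause) (r : Fin 6) (h : Hub) : g c r ≠ .hub h := by
  fin_cases r <;> simp [g]

theorem g_ne_q (c d : Clause) (r : Fin 6) (j : Fin 8) : g c r ≠ .q d j := by
  fin_cases r <;> simp [g]

theorem isEdge_hub_left {h : Hub} {b : Vertex} (e : IsEdge I (.hub h) b) :
    (h = .hu ∧ b = .hub .hu') ∨ (h = .hu' ∧ b = .hub .u) ∨ (h = .u ∧ b = .hub .v) ∨
      (h = .v ∧ b = .hub .hv') ∨ (h = .hv' ∧ b = .hub .hv) := by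
  -- The left end `g c i` of a matrix edge is not a constructor application, so the index is made a
  -- variable before the case analysis.
  generalize ha : Vertex.hub h = a at e
  cases e with
  | matrix c hc i j h => exact absurd ha.symm (g_ne_hub _ _ _)
  | _ => simp_all

theorem isEdge_hub_right {h : Hub} {a : Vertex} (e : IsEdge I a (.hub h)) :
    (∃ x, a = .var x ∧ (h = .u ∨ h = .v)) ∨
      (∃ c i, a = .copy c i ∧
        ((h = .u ∧ (c.lit i).pos = true) ∨ (h = .v ∧ (c.lit i).pos = false))) ∨
      (a = .hub .hu ∧ h = .hu') ∨ (a = .hub .hu' ∧ h = .u) ∨ (a = .hub .u ∧ h = .v) ∨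
      (a = .hub .v ∧ h = .hv') ∨ (a = .hub .hv' ∧ h = .hv) := by
  cases e with
  | positive c hc i hp => exact .inr (.inl ⟨c, i, rfl, by simp [hp]⟩)
  | negative c hc i hp => exact .inr (.inl ⟨c, i, rfl, by simp [hp]⟩)
  | _ => simp

theorem isEdge_q_left {c : Clause} {j : Fin 8} {b : Vertex} (e : IsEdge I (.q c j) b) :
    ∃ j', b = .q c j' := by
  generalize ha : Vertex.q c j = a at e
  cases e with
  | matrix c hc i j h => exact absurd ha.symm (g_ne_q _ _ _ _)
  | _ => simp_all

theorem isEdge_q_right {c : Clause} {j : Fin 8} {a : Vertex} (e : IsEdge I a (.q c j)) :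
    (∃ r, M r j = 1 ∧ a = g c r) ∨ ∃ j', a = .q c j' := by
  cases e with
  | matrix c hc i j h => exact .inl ⟨i, h, rfl⟩
  | path c hc j => exact .inr ⟨_, rfl⟩

/-- The vertices adjacent to `q c j`. -/
theorem adj_q {c : Clause} {j : Fin 8} {hq : IsVertex I (.q c j)} {z : vertexSet I}
    (h : (f I).Adj ⟨.q c j, hq⟩ z) :
    (∃ r, M r j = 1 ∧ (z : Vertex) = g c r) ∨ ∃ j', (z : Vertex) = .q c j' := by
  rcases f_adj.1 h with h | h
  · exact .inr (isEdge_q_left h)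
  · exact isEdge_q_right h

theorem not_adj_q_hub {c : Clause} {j : Fin 8} {hq : IsVertex I (.q c j)} {h : Hub}
    {hh : IsVertex I (.hub h)} : ¬ (f I).Adj ⟨.q c j, hq⟩ ⟨.hub h, hh⟩ := by
  intro e
  rcases adj_q e with ⟨r, -, h'⟩ | ⟨j', h'⟩
  · exact g_ne_hub _ _ _ h'.symm
  · cases h'

theorem eq_of_adj_copy_sideHub {c : Clause} {i : Fin 3} {s : Bool} {hi : IsVertex I (.copy c i)}
    {hs : IsVertex I (sideHub s)} (h : (f I).Adj ⟨.copy c i, hi⟩ ⟨sideHub s, hs⟩) :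
    (c.lit i).pos = s := by
  rcases f_adj.1 h with h | h
  · rcases isEdge_hub_right h with ⟨x, h, -⟩ | ⟨c', i', h, h'⟩ | h | h | h | h | h
    · cases h
    · cases h
      cases s <;> simpa using h'
    all_goals simp at h
  · have := isEdge_hub_left h
    simp at this

/-- The end of the path of hub vertices at a side. -/
def farHub (s : Bool) : vertexSet I := ⟨.hub (if s then .hu else .hv), .hub _⟩

/-- The second vertex of the path of hub vertices at a side. -/
def midHub (s : Bool) : vertexSet I := ⟨.hub (if s then .hu' else .hv'), .hub _⟩

/-- The end of the edge `uv` at a side. -/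
def nearHub (s : Bool) : vertexSet I := ⟨sideHub s, isVertex_sideHub s⟩

theorem adj_farHub {s : Bool} {z : vertexSet I} (h : (f I).Adj (farHub s) z) : z = midHub s := by
  apply Subtype.ext
  rcases f_adj.1 h with h | h
  · have := isEdge_hub_left h
    cases s <;> simp_all [midHub]
  · have := isEdge_hub_right h
    cases s <;> simp_all [midHub]

theorem adj_midHub {s : Bool} {z : vertexSet I} (h : (f I).Adj (midHub s) z) :
    z = farHub s ∨ z = nearHub s := by
  simp only [Subtype.ext_iff]
  rcases f_adj.1 h with h | h
  · have := isEdge_hub_left h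
    cases s <;> simp_all [farHub, nearHub, sideHub]
  · have := isEdge_hub_right h
    cases s <;> simp_all [farHub, nearHub, sideHub]

end Inversion

/-! ### Spanning trees of diameter at most 5 -/

section Spanner

variable {I : Instance} {T : SimpleGraph (vertexSet I)}

theorem dist_nearHub_add_two_le (hsub : T ≤ f I) (hT : T.Connected) {s : Bool} {y : vertexSet I}
    (h1 : farHub s ≠ y) (h2 : midHub s ≠ y) :
    T.dist (nearHub s) y + 2 ≤ T.dist (farHub s) y :=
  dist_add_two_le hT (fun _ hz => adj_farHub (hsub hz)) (fun _ hz => adj_midHub (hsub hz)) h1 h2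

theorem dist_le_five (hT : T.Connected) (hd : T.ediam ≤ 5) (x y : vertexSet I) :
    T.dist x y ≤ 5 := by
  have h := (edist_le_ediam (u := x) (v := y)).trans hd
  rw [← (hT x y).coe_dist_eq_edist] at h
  exact_mod_cast h

/-- The far ends of the two pendant paths are at distance `4 + T.dist u v`, which is at most 5. -/
theorem adj_nearHub (hsub : T ≤ f I) (hT : T.Connected) (hd : T.ediam ≤ 5) (s : Bool) :
    T.Adj (nearHub s) (nearHub !s) := by
  have h1 := dist_nearHub_add_two_le hsub hT (s := s) (y := farHub !s)
    (by cases s <;> simp [farHub]) (by cases s <;> simp [farHub, midHub])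
  have h2 := dist_nearHub_add_two_le hsub hT (s := !s) (y := nearHub s)
    (by cases s <;> simp [farHub, nearHub, sideHub])
    (by cases s <;> simp [nearHub, midHub, sideHub])
  rw [dist_comm, dist_comm (u := farHub !s)] at h2
  have h3 := dist_le_five hT hd (farHub s) (farHub !s)
  have h4 : T.dist (nearHub s) (nearHub !s) ≠ 0 := by
    rw [hT.dist_eq_zero_iff.ne]
    cases s <;> simp [nearHub, sideHub]
  rw [← dist_eq_one_iff_adj]
  omega

theorem dist_nearHub_q_le (hsub : T ≤ f I) (hT : T.Connected) (hd : T.ediam ≤ 5) (s : Bool)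
    {c : Clause} {j : Fin 8} (hq : IsVertex I (.q c j)) :
    T.dist (nearHub s) ⟨.q c j, hq⟩ ≤ 3 := by
  have h1 := dist_nearHub_add_two_le hsub hT (s := s) (y := ⟨.q c j, hq⟩)
    (ne_of_apply_ne Subtype.val (by simp [farHub])) (ne_of_apply_ne Subtype.val (by simp [midHub]))
  have h2 := dist_le_five hT hd (farHub s) ⟨.q c j, hq⟩
  omega

theorem two_le_dist_nearHub_q (hsub : T ≤ f I) (hT : T.Connected) (s : Bool)
    {c : Clause} {j : Fin 8} (hq : IsVertex I (.q c j)) :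
    2 ≤ T.dist (nearHub s) ⟨.q c j, hq⟩ := by
  have h1 : T.dist (nearHub s) ⟨.q c j, hq⟩ ≠ 0 := by
    rw [hT.dist_eq_zero_iff.ne]
    exact ne_of_apply_ne Subtype.val (by simp [nearHub, sideHub])
  have h2 : T.dist (nearHub s) ⟨.q c j, hq⟩ ≠ 1 := by
    rw [Ne, dist_eq_one_iff_adj]
    exact fun h => not_adj_q_hub (hsub h).symm
  omega

/-- Both distances are 2 or 3, and in a tree no vertex is equidistant from two adjacent vertices. -/
theorem dist_nearHub_q (hsub : T ≤ f I) (hT : T.IsTree) (hd : T.ediam ≤ 5)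
    {c : Clause} {j : Fin 8} (hq : IsVertex I (.q c j)) : ∃ s,
      T.dist (nearHub s) ⟨.q c j, hq⟩ = 2 ∧ T.dist (nearHub !s) ⟨.q c j, hq⟩ = 3 := by
  have h1 := fun s => two_le_dist_nearHub_q hsub hT.connected s hq
  have h2 := fun s => dist_nearHub_q_le hsub hT.connected hd s hq
  have h3 := hT.dist_ne_of_adj ⟨.q c j, hq⟩ (adj_nearHub hsub hT.connected hd true)
  rw [dist_comm, dist_comm (v := nearHub !true)] at h3
  have h4 := h1 true
  have h5 := h1 false
  have h6 := h2 true
  have h7 := h2 false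
  simp only [Bool.not_true] at h3
  by_cases h : T.dist (nearHub true) ⟨.q c j, hq⟩ = 2
  · exact ⟨true, h, by simp only [Bool.not_true]; omega⟩
  · exact ⟨false, by omega, by simp only [Bool.not_false]; omega⟩

/-- Two vertices at distance two from different ends of the edge `uv` have distance five. -/
theorem dist_eq_five (hT : T.IsTree) {s : Bool} {x y : vertexSet I}
    (huv : T.Adj (nearHub s) (nearHub !s))
    (hx : T.dist (nearHub s) x = 2) (hx' : T.dist (nearHub !s) x = 3)
    (hy : T.dist (nearHub !s) y = 2) (hy' : T.dist (nearHub s) y = 3) : T.dist x y = 5 := by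
  rw [dist_comm] at hx
  obtain ⟨z, hxz, hzs⟩ := exists_adj_adj_of_dist_eq_two hx
  obtain ⟨w, hsw, hwy⟩ := exists_adj_adj_of_dist_eq_two hy
  have h1 := dist_eq_one_iff_adj.2 huv
  have h2 := dist_eq_one_iff_adj.2 hzs
  have h3 := dist_eq_one_iff_adj.2 hsw
  have h4 := dist_eq_one_iff_adj.2 hxz.symm
  have h5 := dist_eq_one_iff_adj.2 hwy
  rw [dist_comm] at hx h2
  have t1 := hT.connected.dist_triangle (u := nearHub !s) (v := z) (w := x)
  have t2 := hT.connected.dist_triangle (u := nearHub !s) (v := nearHub s) (w := z)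
  have t3 := hT.connected.dist_triangle (u := nearHub s) (v := w) (w := y)
  have t4 := hT.connected.dist_triangle (u := nearHub s) (v := nearHub !s) (w := w)
  have c5 : T.dist (nearHub !s) (nearHub s) = T.dist (nearHub s) (nearHub !s) := dist_comm
  have c6 : T.dist (nearHub s) (nearHub s) = 0 := dist_self
  have c7 : T.dist (nearHub !s) (nearHub !s) = 0 := dist_self
  let p : T.Walk x y := .cons hxz (.cons hzs (.cons huv (.cons hsw (.cons hwy .nil))))
  -- The distances to the two ends of `uv` separate the six vertices of the walk. So the walk is a
  -- path, and paths in a tree are shortest.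
  have hne : ∀ a b : vertexSet I, T.dist (nearHub s) a ≠ T.dist (nearHub s) b ∨
      T.dist (nearHub !s) a ≠ T.dist (nearHub !s) b → a ≠ b := by
    rintro a b h rfl
    simp at h
  have hp : p.IsPath := by
    simp only [p, Walk.cons_isPath_iff, Walk.support_cons, Walk.support_nil, List.mem_cons,
      List.not_mem_nil, or_false, not_or, Walk.isPath_iff_nil, Walk.nil_nil, true_and]
    refine ⟨⟨⟨⟨?_, ?_, ?_⟩, ?_, ?_, ?_⟩, ?_, ?_, ?_, ?_⟩, ?_, ?_, ?_, ?_, ?_⟩ <;>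
      exact hne _ _ (by omega)
  exact (IsAcyclic.length_eq_dist hT.isAcyclic hp).symm

/-- The side is propagated along the path of `q`-vertices: a change between neighbours would mean
tree distance 5 for an edge of the graph, whose ends are at tree distance at most 4. -/
theorem exists_side (hT : IsTreeSpanner 4 (f I) T) (hd : T.ediam ≤ 5) {c : Clause}
    (hc : c ∈ I.properClauses) :
    ∃ s, ∀ j, T.dist (nearHub s) ⟨.q c j, .q c hc j⟩ = 2 := by
  obtain ⟨hsub, hT, hsp⟩ := hT
  obtain ⟨s, hs, -⟩ := dist_nearHub_q hsub hT hd (.q c hc 0)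
  refine ⟨s, fun j => ?_⟩
  induction j using Fin.induction with
  | zero => exact hs
  | succ j ih =>
    have hadj : (f I).Adj ⟨.q c j.castSucc, .q c hc _⟩ ⟨.q c j.succ, .q c hc _⟩ :=
      f_adj.2 (.inl (.path c hc j))
    have h1 := hsp ⟨.q c j.castSucc, .q c hc _⟩ ⟨.q c j.succ, .q c hc _⟩
    rw [dist_eq_one_iff_adj.2 hadj] at h1
    obtain ⟨r, hr, hr'⟩ := dist_nearHub_q hsub hT hd (.q c hc j.succ)
    obtain ⟨r', hr1, hr1'⟩ := dist_nearHub_q hsub hT hd (.q c hc j.castSucc)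
    have e : r' = s := by
      by_contra hne
      rw [← Bool.eq_not_of_ne (Ne.symm hne), ih] at hr1'
      omega
    subst e
    by_cases hrs : r = r'
    · rw [← hrs, hr]
    · obtain rfl := Bool.eq_not_of_ne hrs
      rw [Bool.not_not] at hr'
      have := dist_eq_five hT (adj_nearHub hsub hT.connected hd r') hr1 hr1' hr hr'
      omega

/-- A column of the gadget matrix with given choices of rows. -/
theorem exists_column (b : Fin 3 → Bool) : ∃ j : Fin 8, ∀ i,
    (M (varRow i) j = 1 → b i = true) ∧ (M (copyRow i) j = 1 → b i = false) := by
  revert b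
  decide

theorem satisfiable_of_treeSpanner (hT : IsTreeSpanner 4 (f I) T) (hd : T.ediam ≤ 5) :
    I.Satisfiable := by
  classical
  have hsub := hT.1
  have hT' := hT.2.1
  have huv := adj_nearHub hsub hT'.connected hd
  -- A variable is true if it is joined to `u` in the tree; numbers that are not variables of `I`
  -- get the value false.
  refine ⟨fun x => decide (∃ hx : IsVertex I (.var x), T.Adj ⟨.var x, hx⟩ (nearHub true)),
    fun c hc => ?_⟩
  by_cases ht : c.IsTautology
  · obtain ⟨i, j, hij, hi, hj⟩ := ht
    by_cases h : ∃ hx : IsVertex I (.var (c.lit i).var),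
        T.Adj ⟨.var (c.lit i).var, hx⟩ (nearHub true)
    · exact ⟨i, by simpa [hi] using h⟩
    · exact ⟨j, by rw [← hij, hj]; simpa using h⟩
  obtain ⟨s, hs⟩ := exists_side hT hd (c := c) ⟨hc, ht⟩
  -- This `q`-vertex sees the variables whose literals become true on side `s`, and otherwise only
  -- copies that are joined to the opposite hub.
  obtain ⟨j, hj⟩ := exists_column fun i => decide ((c.lit i).pos = s)
  have h2 := hs j
  rw [dist_comm] at h2
  obtain ⟨⟨z, hz⟩, hqz, hzs⟩ := exists_adj_adj_of_dist_eq_two h2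
  rcases adj_q (hsub hqz) with ⟨r, hr, hzr⟩ | ⟨j', hj'⟩
  · obtain ⟨i, rfl | rfl⟩ := exists_row_eq r
    · have hp := (hj i).1 hr
      simp only [decide_eq_true_eq] at hp
      refine ⟨i, ?_⟩
      simp only [g_varRow] at hzr
      subst hzr
      rw [hp]
      cases s with
      | true => simpa using ⟨hz, hzs⟩
      | false =>
        simp only [decide_eq_false_iff_not]
        rintro ⟨hz', h⟩
        -- A variable joined to both `u` and `v` would close a triangle with `uv`; here it appears
        -- as a vertex equidistant from two adjacent ones.
        refine hT'.dist_ne_of_adj ⟨_, hz⟩ (huv true) ?_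
        rw [dist_eq_one_iff_adj.2 h]
        exact (dist_eq_one_iff_adj.2 hzs).symm
    · have hp := (hj i).2 hr
      simp only [decide_eq_false_iff_not] at hp
      simp only [g_copyRow] at hzr
      subst hzr
      exact absurd (eq_of_adj_copy_sideHub (hsub hzs)) hp
  · simp only at hj'
    subst hj'
    exact absurd (hsub hzs) not_adj_q_hub

end Spanner

end TreeSpanner

/-- The construction `f` is computed in polynomial time by a Turing machine, and an instance `I` of
3-SAT is satisfiable if and only if `f(I)` admits a tree 4-spanner of diameter at most 5. -/
theorem mainTheorem3 :
    (∃ F : TreeSpanner.Instance → TreeSpanner.GraphData TreeSpanner.Vertex,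
      (∀ I, (F I).Represents (TreeSpanner.f I)) ∧
      Nonempty (Turing.TM2ComputableInPolyTime TreeSpanner.encodeInstance
        (TreeSpanner.GraphData.encode TreeSpanner.encodeVertex) F)) ∧
    ∀ I : TreeSpanner.Instance, I.Satisfiable ↔
      ∃ T : SimpleGraph (TreeSpanner.vertexSet I),
        TreeSpanner.IsTreeSpanner 4 (TreeSpanner.f I) T ∧ T.ediam ≤ 5 :=
  ⟨⟨TreeSpanner.graphData, TreeSpanner.graphData_represents, TreeSpanner.nonempty_computable⟩,
    fun _ => ⟨TreeSpanner.exists_treeSpanner,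
      fun ⟨_, hT, hd⟩ => TreeSpanner.satisfiable_of_treeSpanner hT hd⟩⟩
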